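/- For $x_1,\dots,x_n\in[0,1]^d$ and $r>0$, let $G(x_1,\dots,x_n;r)$ be the graph on $\{1,\dots,n\}$ in which distinct $i,j$ are adjacent if and only if $\lVert x_i-x_j\rVert\le r$ (Euclidean norm). The random geometric graph is $G^d(n,r)=G(X_1,\dots,X_n;r)$, where $X_1,\dots,X_n$ are independent and uniformly distributed on $[0,1]^d$. A sequence of events $(\mathcal E_n)$ holds asymptotically almost surely (a.a.s.) if $\mathbb P[\mathcal E_n]\to1$ as $n\to\infty$. Theorem. Let $d\ge1$ be an integer and let $\alpha\in(0,1/2)$. There are a constant $C>0$ and a deterministic algorithm $\mathcal A$, both depending only on $d$ and $\alpha$, such that the following holds. (1) Let $r=r(n)$ be a function with $r(n)\ge(C/n)^{1/d}$ for all sufficiently large $n$, and for each $n$ let $H_n$ be a graph on $\{1,\dots,n\}$, with minimum degree at least $\alpha n$ for all sufficiently large $n$. Then a.a.s. $H_n\cup G^d(n,r(n))$ is Hamiltonian. (2) The algorithm $\mathcal A$ receives a graph $H$ on $\{1,\dots,n\}$ (as an adjacency matrix), the coordinates of points $x_1,\dots,x_n\in[0,1]^d$, and a radius $r>0$. On every such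 input with $n\ge1$ it halts within $O(n^2)$ steps, and it either outputs a Hamilton cycle of $H\cup G(x_1,\dots,x_n;r)$ or reports failure. For $r(n)$ and $H_n$ as in (1), a.a.s. it outputs a Hamilton cycle when it is run on $H_n$, $X_1,\dots,X_n$ and $r(n)$. Here a step is an operation of a real RAM whose integer memory cells hold values of at most $n^{O(1)}$ and whose real cells support exact arithmetic and comparison (but no rounding), each at unit cost; the implied constants depend only on $d$ and $\alpha$. As $H_n$ has at least $\alpha n^2/2$ edges for all large $n$, this running time is linear in the size of $H_n\cup G^d(n,r(n))$. -/

import Mathlib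

open MeasureTheory Filter Topology

noncomputable section

namespace PerturbedGeometric

/-! ### Random geometric graphs -/

/-- The unit cube `[0,1]^d` in Euclidean space. -/
def unitCube (d : ℕ) : Set (EuclideanSpace ℝ (Fin d)) :=
  {x | ∀ k, x k ∈ Set.Icc (0 : ℝ) 1}

/-- The uniform distribution on `[0,1]^d`. -/
def uniformCube (d : ℕ) : Measure (EuclideanSpace ℝ (Fin d)) :=
  volume.restrict (unitCube d)

theorem volume_unitCube (d : ℕ) : volume (unitCube d) = 1 := by
  have hs : MeasurableSet (Set.pi Set.univ fun _ : Fin d => Set.Icc (0 : ℝ) 1) :=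
    MeasurableSet.univ_pi fun _ => measurableSet_Icc
  have h := (PiLp.volume_preserving_ofLp (Fin d)).measure_preimage hs.nullMeasurableSet
  have h2 : (WithLp.ofLp ⁻¹' (Set.pi Set.univ fun _ : Fin d => Set.Icc (0 : ℝ) 1) :
      Set (EuclideanSpace ℝ (Fin d))) = unitCube d := by
    ext x
    simp only [unitCube, Set.mem_preimage, Set.mem_pi, Set.mem_univ, true_imp_iff,
      Set.mem_ofPred_eq]
  rw [h2] at h
  rw [h, volume_pi_pi]
  simp

instance (d : ℕ) : IsProbabilityMeasure (uniformCube d) :=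
  ⟨by simp [uniformCube, volume_unitCube]⟩

/-- The joint law of `n` independent uniform points of `[0,1]^d`. -/
def randomPoints (d n : ℕ) : Measure (Fin n → EuclideanSpace ℝ (Fin d)) :=
  Measure.pi fun _ => uniformCube d

instance (d n : ℕ) : IsProbabilityMeasure (randomPoints d n) :=
  inferInstanceAs (IsProbabilityMeasure (Measure.pi fun _ => uniformCube d))

/-- The geometric graph with vertex `i` at position `x i`: two distinct vertices are adjacent
iff their Euclidean distance is at most `r`. With `x` distributed as `randomPoints d n` this is
the random geometric graph `G^d(n,r)`. -/
def geometricGraph {d n : ℕ} (x : Fin n → EuclideanSpace ℝ (Fin d)) (r : ℝ) :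
    SimpleGraph (Fin n) where
  Adj i j := i ≠ j ∧ ‖x i - x j‖ ≤ r
  symm := ⟨fun i j h => ⟨h.1.symm, by rw [norm_sub_rev]; exact h.2⟩⟩
  loopless := ⟨fun _ h => h.1 rfl⟩

/-- A sequence of events, the `n`-th one about `n` independent uniform points of `[0,1]^d`, holds
asymptotically almost surely: its probability tends to `1`. -/
def AAS (d : ℕ) (E : ∀ n : ℕ, (Fin n → EuclideanSpace ℝ (Fin d)) → Prop) : Prop :=
  Tendsto (fun n => randomPoints d n {x | E n x}) atTop (𝓝 1)

/-! ### A machine model: a real RAM with polynomially bounded integer words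

The memory consists of integer arrays and real arrays, each named by a natural number and
initially zero. The input is read-only and is accessed through expressions. A program is a
finite piece of code with natural numbers as its only literals. -/

/-- An input: a graph on `n` vertices (as an adjacency matrix), the table of coordinates of `n`
points of `ℝ^d`, and a radius. -/
structure Input (d n : ℕ) where
  graph : SimpleGraph (Fin n)
  pos : Fin n → EuclideanSpace ℝ (Fin d)
  radius : ℝ

/-- The memory: `nat a i` and `real a i` are the entries with index `i` of the integer array and
of the real array named `a`. -/
structure Store where
  nat : ℕ → ℕ → ℕ
  real : ℕ → ℕ → ℝ

/-- The memory at the start. -/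
def Store.init : Store := ⟨fun _ _ => 0, fun _ _ => 0⟩

/-- Write an integer entry. -/
def Store.setNat (σ : Store) (a i v : ℕ) : Store :=
  { σ with nat := fun b j => if b = a ∧ j = i then v else σ.nat b j }

/-- Write a real entry. -/
def Store.setReal (σ : Store) (a i : ℕ) (v : ℝ) : Store :=
  { σ with real := fun b j => if b = a ∧ j = i then v else σ.real b j }

/-- Integer expressions. `size` is the number of vertices, `edge i j` is the entry `(i, j)` of
the adjacency matrix, and `sub` is truncated subtraction. -/
inductive NatExpr where
  | const (c : ℕ)
  | size
  | edge (i j : NatExpr)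
  | get (a : ℕ) (i : NatExpr)
  | add (e f : NatExpr)
  | sub (e f : NatExpr)
  | mul (e f : NatExpr)

/-- Real expressions. `coord i k` is the `k`-th coordinate of the `i`-th point, `radius` is the
radius, and `ofNat` turns an integer into a real number. There is no rounding operation. -/
inductive RealExpr where
  | ofNat (e : NatExpr)
  | coord (i k : NatExpr)
  | radius
  | get (a : ℕ) (i : NatExpr)
  | add (e f : RealExpr)
  | sub (e f : RealExpr)
  | mul (e f : RealExpr)
  | div (e f : RealExpr)

/-- Tests. -/
inductive Test where
  | natLe (e f : NatExpr)
  | realLe (e f : RealExpr)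
  | not (b : Test)
  | and (b c : Test)

/-- Programs. `setNat a i e` and `setReal a i e` assign the value of `e` to the entry with index
`i` of the array `a`; `loop b p` repeats `p` as long as `b` holds. -/
inductive Program where
  | skip
  | setNat (a : ℕ) (i e : NatExpr)
  | setReal (a : ℕ) (i : NatExpr) (e : RealExpr)
  | seq (p q : Program)
  | ite (b : Test) (p q : Program)
  | loop (b : Test) (p : Program)

section semantics

variable {d n : ℕ}

open Classical in
/-- The value of an integer expression. -/
def NatExpr.eval (I : Input d n) (σ : Store) : NatExpr → ℕ
  | .const c => c
  | .size => n
  | .edge e f =>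
      if ∃ (hi : e.eval I σ < n) (hj : f.eval I σ < n),
        I.graph.Adj ⟨e.eval I σ, hi⟩ ⟨f.eval I σ, hj⟩ then 1 else 0
  | .get a e => σ.nat a (e.eval I σ)
  | .add e f => e.eval I σ + f.eval I σ
  | .sub e f => e.eval I σ - f.eval I σ
  | .mul e f => e.eval I σ * f.eval I σ

/-- The value of a real expression. -/
def RealExpr.eval (I : Input d n) (σ : Store) : RealExpr → ℝ
  | .ofNat e => (e.eval I σ : ℝ)
  | .coord e f =>
      if h : e.eval I σ < n ∧ f.eval I σ < d then I.pos ⟨e.eval I σ, h.1⟩ ⟨f.eval I σ, h.2⟩ else 0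
  | .radius => I.radius
  | .get a e => σ.real a (e.eval I σ)
  | .add e f => e.eval I σ + f.eval I σ
  | .sub e f => e.eval I σ - f.eval I σ
  | .mul e f => e.eval I σ * f.eval I σ
  | .div e f => e.eval I σ / f.eval I σ

/-- The truth value of a test. -/
def Test.Holds (I : Input d n) (σ : Store) : Test → Prop
  | .natLe e f => e.eval I σ ≤ f.eval I σ
  | .realLe e f => e.eval I σ ≤ f.eval I σ
  | .not b => ¬ b.Holds I σ
  | .and b c => b.Holds I σ ∧ c.Holds I σ

/-- `Exec I W p σ t τ`: on input `I`, the program `p` started with memory `σ` halts after exactly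
`t` steps with memory `τ`, and every integer that it stores is at most `W`. Every assignment,
every `skip` and every evaluation of a test is one step; as a program is fixed, each of them
involves a bounded number of operations. -/
inductive Exec (I : Input d n) (W : ℕ) : Program → Store → ℕ → Store → Prop
  | skip (σ : Store) : Exec I W .skip σ 1 σ
  | setNat (a : ℕ) (i e : NatExpr) (σ : Store) (h : e.eval I σ ≤ W) :
      Exec I W (.setNat a i e) σ 1 (σ.setNat a (i.eval I σ) (e.eval I σ))
  | setReal (a : ℕ) (i : NatExpr) (e : RealExpr) (σ : Store) :
      Exec I W (.setReal a i e) σ 1 (σ.setReal a (i.eval I σ) (e.eval I σ))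
  | seq {p q : Program} {σ τ υ : Store} {s t : ℕ}
      (hp : Exec I W p σ s τ) (hq : Exec I W q τ t υ) : Exec I W (.seq p q) σ (s + t) υ
  | ite_true {b : Test} {p q : Program} {σ τ : Store} {t : ℕ}
      (hb : b.Holds I σ) (hp : Exec I W p σ t τ) : Exec I W (.ite b p q) σ (t + 1) τ
  | ite_false {b : Test} {p q : Program} {σ τ : Store} {t : ℕ}
      (hb : ¬ b.Holds I σ) (hq : Exec I W q σ t τ) : Exec I W (.ite b p q) σ (t + 1) τ
  | loop_done {b : Test} {p : Program} {σ : Store}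
      (hb : ¬ b.Holds I σ) : Exec I W (.loop b p) σ 1 σ
  | loop_step {b : Test} {p : Program} {σ τ υ : Store} {s t : ℕ}
      (hb : b.Holds I σ) (hp : Exec I W p σ s τ) (hl : Exec I W (.loop b p) τ t υ) :
      Exec I W (.loop b p) σ (s + t + 1) υ

/-- The graph `H ∪ G` of an input: the union of the given graph and of the geometric graph on the
given points with the given radius. -/
def Input.union (I : Input d n) : SimpleGraph (Fin n) :=
  I.graph ⊔ geometricGraph I.pos I.radius

/-- Entry `0` of the integer array `0` of the final memory is the success flag. -/
def Store.Success (σ : Store) : Prop := σ.nat 0 0 ≠ 0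

/-- The first `n` entries of the integer array `1` of the final memory list the vertices of a
Hamilton cycle of `G`, in the order in which the cycle traverses them. -/
def Store.ListsHamiltonCycle (σ : Store) (G : SimpleGraph (Fin n)) : Prop :=
  ∃ (a : Fin n) (p : G.Walk a a), p.IsHamiltonianCycle ∧ ∀ i < n, σ.nat 1 i = (p.getVert i : ℕ)

/-- On input `I`, within `T` steps and with integers bounded by `W`, the program halts and either
outputs a Hamilton cycle of `H ∪ G` or reports failure. -/
def Program.Sound (P : Program) (I : Input d n) (W T : ℕ) : Prop :=
  ∃ t σ, t ≤ T ∧ Exec I W P Store.init t σ ∧ (σ.Success → σ.ListsHamiltonCycle I.union)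

/-- On input `I`, within `T` steps and with integers bounded by `W`, the program halts and outputs
a Hamilton cycle of `H ∪ G`. -/
def Program.FindsHamiltonCycle (P : Program) (I : Input d n) (W T : ℕ) : Prop :=
  ∃ t σ, t ≤ T ∧ Exec I W P Store.init t σ ∧ σ.Success ∧ σ.ListsHamiltonCycle I.union

end semantics

end PerturbedGeometric

end

open PerturbedGeometric

/-! The cube is cut into `N = m ^ d` grid cells, with `m` maximal subject to `L * m ^ d ≤ n`. For `C
= (2 * d) ^ d * L` the radius is at least `d / m`, so every cell is a clique of the geometric graph.
Each nonempty cell becomes one cycle (possibly with one or two vertices), and edges of `H` are used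
to merge these cycles until a single one is left.

Merging (`CycleCover.merge`): let `a` lie on one cycle, and let `x ≠ y` lie in a cell of another
one, with `H`-edges from `next a` to `x` and from `a` to `y`. Bypass `y` by `prev y → next y`, then
join the cycles by `a → y → next x` and `x → next a`. The steps `prev y → next y` and `y → next x`
stay in the cell if `x` and `y` are unused, that is, if their cycle neighbours still lie in their
own cell. A merge uses up at most four vertices and is attempted once per cell, so at most `4 * N`
vertices are ever used.

Progress (`WellSpread.majorLabel`): suppose every vertex has at least 20 `H`-neighbours in all but
`N / 9` of the cells. If no merge is possible for `a`, then all cells except those poor in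
neighbours of `a` or of `next a`, and those with many used vertices, are on the cycle of `a`. The
exceptions are fewer than half of the cells, so this cycle has a majority of them. After all cells
have been processed every cycle has a majority, so there is only one.

Probability (`randomPoints_not_wellSpread_le`): a failure of the hypothesis provides a vertex and a
set of at least `N / 9` cells that receives at most `20 * N` of its neighbours. Chernoff's bound and
a union bound give probability at most `n * 2 ^ (21 * N) * (17 / 18) ^ D` for minimum degree `D ≥ α
* n`, which tends to `0` once `L` is large, because `N ≤ n / L`.

The program carries this out in quadratic time and checks its own output, so a wrong answer is
impossible on any input. Its arrays are 1 output, 2 `next`, 3 `prev`, 4 `cell`, 5 labels, 6 used, 7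
a vertex of each cell, 8 witnesses `x`, 9 visited. The main scalars are 20 `m`, 22 and 23 loop
counters, 24 `y + 1`, 30 `a`, 25 `next a`, 26 `x`, 32 `y`, 31 and 33 the two labels of a merge, 34
the verdict of the check. -/

namespace PerturbedGeometric

/-! ### A program logic for the machine -/

section logic

variable {d n : ℕ}

/-- Started with memory `σ`, the program `p` halts within `T` steps with a memory satisfying `Q`,
and every integer that it stores is at most `W`. -/
def Runs (I : Input d n) (W : ℕ) (p : Program) (σ : Store) (T : ℕ) (Q : Store → Prop) : Prop :=
  ∃ t τ, t ≤ T ∧ Exec I W p σ t τ ∧ Q τ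

variable {I : Input d n} {W : ℕ}

theorem Runs.mono {p : Program} {σ : Store} {T T' : ℕ} {Q Q' : Store → Prop}
    (h : Runs I W p σ T Q) (hT : T ≤ T') (hQ : ∀ τ, Q τ → Q' τ) : Runs I W p σ T' Q' := by
  obtain ⟨t, τ, ht, he, hq⟩ := h
  exact ⟨t, τ, ht.trans hT, he, hQ τ hq⟩

theorem Runs.skip {σ : Store} {Q : Store → Prop} (h : Q σ) : Runs I W .skip σ 1 Q :=
  ⟨1, σ, le_rfl, .skip σ, h⟩

theorem Runs.setNat {a : ℕ} {i e : NatExpr} {σ : Store} {Q : Store → Prop}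
    (he : e.eval I σ ≤ W) (h : Q (σ.setNat a (i.eval I σ) (e.eval I σ))) :
    Runs I W (.setNat a i e) σ 1 Q :=
  ⟨1, _, le_rfl, .setNat a i e σ he, h⟩

theorem Runs.seq {p q : Program} {σ : Store} {S T : ℕ} {R Q : Store → Prop}
    (hp : Runs I W p σ S R) (hq : ∀ τ, R τ → Runs I W q τ T Q) :
    Runs I W (.seq p q) σ (S + T) Q := by
  obtain ⟨s, τ, hs, hpe, hR⟩ := hp
  obtain ⟨t, υ, ht, hqe, hQ⟩ := hq τ hR
  exact ⟨s + t, υ, by omega, .seq hpe hqe, hQ⟩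

/-- An assignment followed by a program. -/
theorem Runs.setNat_seq {a : ℕ} {i e : NatExpr} {q : Program} {σ : Store} {T : ℕ}
    {Q : Store → Prop} (he : e.eval I σ ≤ W)
    (h : Runs I W q (σ.setNat a (i.eval I σ) (e.eval I σ)) T Q) :
    Runs I W (.seq (.setNat a i e) q) σ (1 + T) Q :=
  Runs.seq (R := fun τ => τ = σ.setNat a (i.eval I σ) (e.eval I σ)) (.setNat he rfl)
    (by rintro τ rfl; exact h)

theorem Runs.ite {b : Test} {p q : Program} {σ : Store} {T : ℕ} {Q : Store → Prop}
    (hp : b.Holds I σ → Runs I W p σ T Q) (hq : ¬ b.Holds I σ → Runs I W q σ T Q) :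
    Runs I W (.ite b p q) σ (T + 1) Q := by
  by_cases hb : b.Holds I σ
  · obtain ⟨t, τ, ht, he, hQ⟩ := hp hb
    exact ⟨t + 1, τ, by omega, .ite_true hb he, hQ⟩
  · obtain ⟨t, τ, ht, he, hQ⟩ := hq hb
    exact ⟨t + 1, τ, by omega, .ite_false hb he, hQ⟩

/-- A loop whose variant `M - v` decreases, where `v` is bounded by `M` under the invariant. -/
theorem Runs.loop {b : Test} {p : Program} {T M : ℕ} {Inv : ℕ → Store → Prop} {Q : Store → Prop}
    (step : ∀ i σ, Inv i σ → b.Holds I σ → i < M ∧ Runs I W p σ T (Inv (i + 1)))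
    (done : ∀ i σ, Inv i σ → ¬ b.Holds I σ → Q σ) :
    ∀ (k i : ℕ) (σ : Store), M ≤ i + k → Inv i σ → Runs I W (.loop b p) σ (k * (T + 1) + 1) Q := by
  intro k
  induction k with
  | zero =>
    intro i σ hk hi
    have hb : ¬ b.Holds I σ := fun hb => by have := (step i σ hi hb).1; omega
    exact ⟨1, σ, by omega, .loop_done hb, done i σ hi hb⟩
  | succ k ih =>
    intro i σ hk hi
    by_cases hb : b.Holds I σ
    · obtain ⟨-, s, τ, hs, hpe, hτ⟩ := step i σ hi hb
      obtain ⟨t, υ, ht, hle, hQ⟩ := ih (i + 1) τ (by omega) hτ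
      refine ⟨s + t + 1, υ, ?_, .loop_step hb hpe hle, hQ⟩
      have : (k + 1) * (T + 1) = k * (T + 1) + (T + 1) := by ring
      omega
    · exact ⟨1, σ, by omega, .loop_done hb, done i σ hi hb⟩

@[simp] theorem Store.setNat_nat (σ : Store) (a i v b : ℕ) :
    (σ.setNat a i v).nat b = if b = a then Function.update (σ.nat a) i v else σ.nat b := by
  funext j
  by_cases h : b = a
  · subst h
    by_cases hj : j = i <;> simp [Store.setNat, hj, Function.update]
  · simp [Store.setNat, h]

/-- The entry `0` of an array, used as a scalar variable. -/
abbrev scalar (c : ℕ) : NatExpr := .get c (.const 0)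

/-- The test `e < f`. -/
def Test.natLt (e f : NatExpr) : Test := .natLe (.add e (.const 1)) f

/-- The test `e = f`. -/
def Test.natEq (e f : NatExpr) : Test := .and (.natLe e f) (.natLe f e)

/-- The test `e ≠ f`. -/
def Test.natNe (e f : NatExpr) : Test := .not (.natEq e f)

@[simp] theorem Test.holds_natLt (σ : Store) (e f : NatExpr) :
    (Test.natLt e f).Holds I σ ↔ e.eval I σ < f.eval I σ := by
  simp [Test.natLt, Test.Holds, NatExpr.eval]

@[simp] theorem Test.holds_natEq (σ : Store) (e f : NatExpr) :
    (Test.natEq e f).Holds I σ ↔ e.eval I σ = f.eval I σ := by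
  simp [Test.natEq, Test.Holds, le_antisymm_iff]

@[simp] theorem Test.holds_natNe (σ : Store) (e f : NatExpr) :
    (Test.natNe e f).Holds I σ ↔ e.eval I σ ≠ f.eval I σ := by
  simp [Test.natNe, Test.Holds]

@[simp] theorem Test.holds_and (σ : Store) (b c : Test) :
    (Test.and b c).Holds I σ ↔ b.Holds I σ ∧ c.Holds I σ := by
  simp [Test.Holds]

@[simp] theorem NatExpr.eval_const (σ : Store) (c : ℕ) : (NatExpr.const c).eval I σ = c := rfl
@[simp] theorem NatExpr.eval_size (σ : Store) : NatExpr.size.eval I σ = n := rfl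
@[simp] theorem NatExpr.eval_get (σ : Store) (a : ℕ) (e : NatExpr) :
    (NatExpr.get a e).eval I σ = σ.nat a (e.eval I σ) := rfl
@[simp] theorem NatExpr.eval_add (σ : Store) (e f : NatExpr) :
    (NatExpr.add e f).eval I σ = e.eval I σ + f.eval I σ := rfl
@[simp] theorem NatExpr.eval_sub (σ : Store) (e f : NatExpr) :
    (NatExpr.sub e f).eval I σ = e.eval I σ - f.eval I σ := rfl
@[simp] theorem NatExpr.eval_mul (σ : Store) (e f : NatExpr) :
    (NatExpr.mul e f).eval I σ = e.eval I σ * f.eval I σ := rfl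

/-- Adjacency in the given graph, for vertices named by natural numbers. -/
def Input.EdgeN (I : Input d n) (u v : ℕ) : Prop :=
  ∃ (hu : u < n) (hv : v < n), I.graph.Adj ⟨u, hu⟩ ⟨v, hv⟩

theorem Input.EdgeN.symm {u v : ℕ} (h : I.EdgeN u v) : I.EdgeN v u := by
  obtain ⟨hu, hv, h⟩ := h
  exact ⟨hv, hu, h.symm⟩

/-- The test that the values of two expressions are adjacent vertices of the given graph. -/
def Test.edge (e f : NatExpr) : Test := .natLe (.const 1) (.edge e f)

@[simp] theorem Test.holds_edge (σ : Store) (e f : NatExpr) :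
    (Test.edge e f).Holds I σ ↔ I.EdgeN (e.eval I σ) (f.eval I σ) := by
  simp only [Test.edge, Test.Holds, NatExpr.eval, Input.EdgeN]
  split_ifs with h <;> simp [h]

/-- `for c = 0, …, n - 1 do p`. -/
def Program.forN (c : ℕ) (p : Program) : Program :=
  .seq (.setNat c (.const 0) (.const 0)) (.loop (.natLt (scalar c) .size)
    (.seq p (.setNat c (.const 0) (.add (scalar c) (.const 1)))))

/-- The rule for a counting loop: the invariant does not mention the counter `c`. -/
theorem Runs.forN {c : ℕ} {p : Program} {σ : Store} {T : ℕ} (Inv : ℕ → Store → Prop)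
    (hW : n ≤ W) (hc : ∀ i τ v, Inv i τ → Inv i (τ.setNat c 0 v)) (h0 : Inv 0 σ)
    (step : ∀ i τ, i < n → τ.nat c 0 = i → Inv i τ →
      Runs I W p τ T (fun υ => υ.nat c 0 = i ∧ Inv (i + 1) υ)) :
    Runs I W (.forN c p) σ (n * (T + 2) + 2) (Inv n) := by
  have h := Runs.loop (I := I) (W := W) (b := .natLt (scalar c) .size)
    (p := .seq p (.setNat c (.const 0) (.add (scalar c) (.const 1)))) (T := T + 1) (M := n)
    (Inv := fun i τ => i ≤ n ∧ τ.nat c 0 = i ∧ Inv i τ) (Q := Inv n)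
    (by
      rintro i τ ⟨hi, hci, hInv⟩ hb
      have hlt : i < n := by simpa [hci] using hb
      refine ⟨hlt, ?_⟩
      refine Runs.seq (step i τ hlt hci hInv) ?_
      rintro υ ⟨hυ, hI⟩
      refine Runs.setNat (by simp [hυ]; omega) ?_
      refine ⟨hlt, by simp [hυ], by simpa [hυ] using hc _ _ _ hI⟩)
    (by
      rintro i τ ⟨hi, hci, hInv⟩ hb
      have : ¬ i < n := by simpa [hci] using hb
      obtain rfl : i = n := by omega
      exact hInv)
    n 0 (σ.setNat c 0 0) (by omega) ⟨by omega, by simp, hc _ _ _ h0⟩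
  refine (Runs.setNat_seq (I := I) (W := W) (by simp) (by simpa using h)).mono ?_ (fun _ h => h)
  have : n * (T + 2) = n * (T + 1 + 1) := by ring
  omega

end logic

/-! ### Covers of the vertex set by cycles -/

section cover

/-- The successor function `next` with inverse `prev` covers `{0, …, n - 1}` by directed cycles.
The steps follow the relation `E` or stay in one cell, and stay in one cell around a vertex that
has not been used. The cells are labelled by `comp`, which is constant on every cycle, and the
vertices in the cells of one label form exactly one cycle. -/
structure CycleCover (n : ℕ) (E : ℕ → ℕ → Prop) (cell next prev used comp : ℕ → ℕ) : Prop where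
  next_lt : ∀ u < n, next u < n
  prev_lt : ∀ u < n, prev u < n
  prev_next : ∀ u < n, prev (next u) = u
  next_prev : ∀ u < n, next (prev u) = u
  step : ∀ u < n, E u (next u) ∨ cell u = cell (next u)
  cell_next : ∀ u < n, used u = 0 → cell (next u) = cell u
  cell_prev : ∀ u < n, used u = 0 → cell (prev u) = cell u
  comp_next : ∀ u < n, comp (cell (next u)) = comp (cell u)
  -- Connectedness is phrased through properties invariant under `next`, so that no walks or
  -- iterates have to be followed through a merge.
  conn : ∀ P : ℕ → Prop, (∀ u < n, P u ↔ P (next u)) →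
    ∀ u < n, ∀ v < n, comp (cell u) = comp (cell v) → (P u ↔ P v)

variable {n : ℕ} {E : ℕ → ℕ → Prop} {cell next prev used comp : ℕ → ℕ}

/-- A property inherited by successors is inherited by predecessors. -/
theorem CycleCover.of_next (h : CycleCover n E cell next prev used comp) {P : ℕ → Prop}
    (hP : ∀ u < n, P u → P (next u)) : ∀ u < n, P u ↔ P (next u) := by
  classical
  intro u hu
  refine ⟨hP u hu, fun hnu => ?_⟩
  -- `next` maps this finite set injectively into itself, hence onto itself. So if `next u` belongs
  -- to it, then so does its only preimage `u`.
  set T := (Finset.range n).filter P with hT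
  have hsub : T.image next ⊆ T := by
    intro w hw
    obtain ⟨v, hv, rfl⟩ := Finset.mem_image.1 hw
    simp only [hT, Finset.mem_filter, Finset.mem_range] at hv ⊢
    exact ⟨h.next_lt v hv.1, hP v hv.1 hv.2⟩
  have hcard : (T.image next).card = T.card := by
    refine Finset.card_image_of_injOn ?_
    intro v hv w hw hvw
    simp only [hT, Finset.coe_filter, Finset.mem_range, Set.mem_ofPred_eq] at hv hw
    have := congrArg prev hvw
    rwa [h.prev_next v hv.1, h.prev_next w hw.1] at this
  have heq := Finset.eq_of_subset_of_card_le hsub hcard.ge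
  have hmem : next u ∈ T.image next := by
    rw [heq]
    simp only [hT, Finset.mem_filter, Finset.mem_range]
    exact ⟨h.next_lt u hu, hnu⟩
  obtain ⟨v, hv, hvu⟩ := Finset.mem_image.1 hmem
  simp only [hT, Finset.mem_filter, Finset.mem_range] at hv
  have := congrArg prev hvu
  rw [h.prev_next v hv.1, h.prev_next u hu] at this
  exact this ▸ hv.2

/-- Induction along a cycle: thanks to finiteness, closure under `next` alone is enough to reach
every vertex of the same label. -/
theorem CycleCover.conn_of_next (h : CycleCover n E cell next prev used comp) {P : ℕ → Prop}
    (hP : ∀ u < n, P u → P (next u)) {u v : ℕ} (hu : u < n) (hv : v < n)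
    (huv : comp (cell u) = comp (cell v)) (hPu : P u) : P v :=
  (h.conn P (h.of_next hP) u hu v hv huv).1 hPu

/-- A vertex `x` can be followed by `next a`, and `a` by `y`, where `x` and `y` are unused vertices
of one cell that lies on another cycle than `a`. -/
structure Mergeable (n : ℕ) (E : ℕ → ℕ → Prop) (cell next prev used comp : ℕ → ℕ)
    (a x y : ℕ) : Prop where
  lt_a : a < n
  lt_x : x < n
  lt_y : y < n
  edge_x : E (next a) x
  edge_y : E a y
  used_x : used x = 0
  used_y : used y = 0
  cell_eq : cell x = cell y
  comp_ne : comp (cell y) ≠ comp (cell a)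
  ne : y ≠ x
  prev_ne : prev y ≠ x

/-- The successor function after merging the cycles of `a` and `x`, where `y` is moved between `a`
and the former successor of `x`. -/
def mergeNext (next prev : ℕ → ℕ) (a x y : ℕ) : ℕ → ℕ :=
  Function.update (Function.update (Function.update (Function.update next x (next a)) a y)
    y (next x)) (prev y) (next y)

/-- The inverse of `mergeNext`. -/
def mergePrev (next prev : ℕ → ℕ) (a x y : ℕ) : ℕ → ℕ :=
  Function.update (Function.update (Function.update (Function.update prev (next a) x) y a)
    (next x) y) (next y) (prev y)

/-- The used vertices after a merge. -/
def mergeUsed (used next : ℕ → ℕ) (a x y : ℕ) : ℕ → ℕ :=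
  Function.update (Function.update (Function.update (Function.update used a 1) (next a) 1) x 1) y 1

/-- The labels of the cells after a merge. -/
def mergeComp (n : ℕ) (comp : ℕ → ℕ) (k l : ℕ) : ℕ → ℕ :=
  fun c => if c < n ∧ comp c = k then l else comp c

/-- Only the steps out of `x`, `a`, `y` and `prev y` change. The two new steps at `y` and `prev y`
stay in one cell because `x` and `y` are unused, and the other two follow `E`. The condition `prev y
≠ x` keeps the two operations on the second cycle, bypassing `y` and opening it after `x`, apart
from each other. -/
theorem CycleCover.merge (h : CycleCover n E cell next prev used comp)
    (hE : ∀ u v, E u v → E v u) (hcell : ∀ u < n, cell u < n) {a x y : ℕ}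
    (m : Mergeable n E cell next prev used comp a x y) :
    CycleCover n E cell (mergeNext next prev a x y) (mergePrev next prev a x y)
      (mergeUsed used next a x y) (mergeComp n comp (comp (cell a)) (comp (cell x))) := by
  obtain ⟨ha, hx, hy, eX, eY, uX, uY, hc, hne, yx, px⟩ := m
  have hna := h.next_lt a ha
  have hnx := h.next_lt x hx
  have hny := h.next_lt y hy
  have hpy := h.prev_lt y hy
  have cna := h.comp_next a ha
  have cnx := h.cell_next x hx uX
  have cny := h.cell_next y hy uY
  have cpy := h.cell_prev y hy uY
  have nxy : next x ≠ y := fun e => px (by rw [← e, h.prev_next x hx])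
  -- A fixed point would be a whole cycle by itself, but `x` lies on the cycle of `y`.
  have nyy : next y ≠ y := by
    intro e
    have := h.conn_of_next (P := fun u => u = y) (by rintro u - rfl; exact e) hy hx
      (by rw [hc]) rfl
    exact yx this.symm
  have pyy : prev y ≠ y := fun e => nyy (by conv_lhs => rw [← e, h.next_prev y hy])
  have ax : a ≠ x := by rintro rfl; rw [hc] at hne; exact hne rfl
  have ay : a ≠ y := by rintro rfl; exact hne rfl
  have apy : a ≠ prev y := by intro e; rw [← e] at cpy; rw [cpy] at hne; exact hne rfl
  have inj : ∀ u < n, ∀ v < n, next u = next v → u = v := fun u hu v hv e => by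
    rw [← h.prev_next u hu, e, h.prev_next v hv]
  have nay : next a ≠ y := by intro e; rw [e] at cna; exact hne cna
  have nanx : next a ≠ next x := fun e => ax (inj _ ha _ hx e)
  have nany : next a ≠ next y := fun e => ay (inj _ ha _ hy e)
  have nxny : next x ≠ next y := fun e => yx (inj _ hx _ hy e).symm
  have vx : mergeNext next prev a x y x = next a := by
    simp [mergeNext, Function.update, px.symm, yx.symm, ax.symm]
  have va : mergeNext next prev a x y a = y := by
    simp [mergeNext, Function.update, apy, ay]
  have vy : mergeNext next prev a x y y = next x := by
    simp [mergeNext, Function.update, pyy.symm]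
  have vp : mergeNext next prev a x y (prev y) = next y := by
    simp [mergeNext, Function.update]
  have vo : ∀ u, u ≠ x → u ≠ a → u ≠ y → u ≠ prev y → mergeNext next prev a x y u = next u := by
    intro u h1 h2 h3 h4
    simp [mergeNext, Function.update, h1, h2, h3, h4]
  have wx : mergePrev next prev a x y (next a) = x := by
    simp [mergePrev, Function.update, nany, nanx, nay]
  have wa : mergePrev next prev a x y y = a := by
    simp [mergePrev, Function.update, nyy.symm, nxy.symm]
  have wy : mergePrev next prev a x y (next x) = y := by
    simp [mergePrev, Function.update, nxny]
  have wp : mergePrev next prev a x y (next y) = prev y := by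
    simp [mergePrev, Function.update]
  have wo : ∀ u, u ≠ next a → u ≠ y → u ≠ next x → u ≠ next y →
      mergePrev next prev a x y u = prev u := by
    intro u h1 h2 h3 h4
    simp [mergePrev, Function.update, h1, h2, h3, h4]
  have cases4 : ∀ Q : ℕ → Prop, Q x → Q a → Q y → Q (prev y) →
      (∀ u < n, u ≠ x → u ≠ a → u ≠ y → u ≠ prev y → Q u) → ∀ u < n, Q u := by
    intro Q q1 q2 q3 q4 q5 u hu
    by_cases h1 : u = x
    · exact h1 ▸ q1
    by_cases h2 : u = a
    · exact h2 ▸ q2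
    by_cases h3 : u = y
    · exact h3 ▸ q3
    by_cases h4 : u = prev y
    · exact h4 ▸ q4
    exact q5 u hu h1 h2 h3 h4
  have cases4' : ∀ Q : ℕ → Prop, Q (next a) → Q y → Q (next x) → Q (next y) →
      (∀ u < n, u ≠ next a → u ≠ y → u ≠ next x → u ≠ next y → Q u) → ∀ u < n, Q u := by
    intro Q q1 q2 q3 q4 q5 u hu
    by_cases h1 : u = next a
    · exact h1 ▸ q1
    by_cases h2 : u = y
    · exact h2 ▸ q2
    by_cases h3 : u = next x
    · exact h3 ▸ q3
    by_cases h4 : u = next y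
    · exact h4 ▸ q4
    exact q5 u hu h1 h2 h3 h4
  have used4 : ∀ u, mergeUsed used next a x y u = 0 →
      u ≠ a ∧ u ≠ next a ∧ u ≠ x ∧ u ≠ y ∧ used u = 0 := by
    intro u hu
    by_cases h1 : u = y
    · simp [mergeUsed, h1] at hu
    by_cases h2 : u = x
    · simp [mergeUsed, Function.update, h2] at hu
    by_cases h3 : u = next a
    · simp [mergeUsed, Function.update, h3] at hu
    by_cases h4 : u = a
    · simp [mergeUsed, Function.update, h4] at hu
    refine ⟨h4, h3, h2, h1, ?_⟩
    simpa [mergeUsed, Function.update, h1, h2, h3, h4] using hu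
  have mA : mergeComp n comp (comp (cell a)) (comp (cell x)) (cell a) = comp (cell x) := by
    simp [mergeComp, hcell a ha]
  have mX : mergeComp n comp (comp (cell a)) (comp (cell x)) (cell x) = comp (cell x) := by
    simp only [mergeComp]; split_ifs <;> rfl
  have mC : ∀ u < n, ∀ v < n, comp (cell u) = comp (cell v) →
      mergeComp n comp (comp (cell a)) (comp (cell x)) (cell u) =
      mergeComp n comp (comp (cell a)) (comp (cell x)) (cell v) := by
    intro u hu v hv e
    simp [mergeComp, hcell u hu, hcell v hv, e]
  refine ⟨?_, ?_, ?_, ?_, ?_, ?_, ?_, ?_, ?_⟩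
  · refine cases4 _ (by rwa [vx]) (by rwa [va]) (by rwa [vy]) (by rwa [vp]) ?_
    intro u hu h1 h2 h3 h4
    rw [vo u h1 h2 h3 h4]; exact h.next_lt u hu
  · refine cases4' _ (by rwa [wx]) (by rwa [wa]) (by rwa [wy]) (by rwa [wp]) ?_
    intro u hu h1 h2 h3 h4
    rw [wo u h1 h2 h3 h4]; exact h.prev_lt u hu
  · refine cases4 _ (by rw [vx, wx]) (by rw [va, wa]) (by rw [vy, wy]) (by rw [vp, wp]) ?_
    intro u hu h1 h2 h3 h4
    rw [vo u h1 h2 h3 h4, wo, h.prev_next u hu]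
    · exact fun e => h2 (inj _ hu _ ha e)
    · exact fun e => h4 (by rw [← e, h.prev_next u hu])
    · exact fun e => h1 (inj _ hu _ hx e)
    · exact fun e => h3 (inj _ hu _ hy e)
  · refine cases4' _ (by rw [wx, vx]) (by rw [wa, va]) (by rw [wy, vy]) (by rw [wp, vp]) ?_
    intro u hu h1 h2 h3 h4
    rw [wo u h1 h2 h3 h4, vo, h.next_prev u hu]
    · exact fun e => h3 (by rw [← e, h.next_prev u hu])
    · exact fun e => h1 (by rw [← e, h.next_prev u hu])
    · exact fun e => h4 (by rw [← e, h.next_prev u hu])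
    · exact fun e => h2 (by rw [← h.next_prev u hu, e, h.next_prev y hy])
  · refine cases4 _ (by rw [vx]; exact .inl (hE _ _ eX)) (by rw [va]; exact .inl eY)
      (by rw [vy]; exact .inr (by rw [cnx, hc])) (by rw [vp]; exact .inr (by rw [cny, cpy])) ?_
    intro u hu h1 h2 h3 h4
    rw [vo u h1 h2 h3 h4]; exact h.step u hu
  · intro u hu huu
    obtain ⟨h1, h2, h3, h4, h5⟩ := used4 u huu
    by_cases h6 : u = prev y
    · rw [h6, vp, cny, cpy]
    · rw [vo u h3 h1 h4 h6]; exact h.cell_next u hu h5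
  · intro u hu huu
    obtain ⟨h1, h2, h3, h4, h5⟩ := used4 u huu
    by_cases h6 : u = next x
    · rw [h6, wy, cnx, hc]
    by_cases h7 : u = next y
    · rw [h7, wp, cny, cpy]
    · rw [wo u h2 h4 h6 h7]; exact h.cell_prev u hu h5
  · refine cases4 _ ?_ ?_ ?_ ?_ ?_
    · rw [vx, mC _ hna _ ha cna, mA, mX]
    · rw [va, ← hc, mX, mA]
    · rw [vy, cnx, hc]
    · rw [vp, cny, cpy]
    · intro u hu h1 h2 h3 h4
      rw [vo u h1 h2 h3 h4]
      exact mC _ (h.next_lt u hu) _ hu (h.comp_next u hu)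
  · intro P hP
    -- On the old cycle of `a` only the step out of `a` has changed, so `P` travels from `next a`
    -- around to `a`. If it failed at `a`, the part of the cycle where it holds would be closed
    -- under `next` and would still have to contain `a`.
    have key : ∀ P : ℕ → Prop, (∀ u < n, P u ↔ P (mergeNext next prev a x y u)) →
        (P (next a) → P a) := by
      intro P hP hPa
      by_contra hcon
      refine hcon (h.conn_of_next (P := fun u => comp (cell u) = comp (cell a) ∧ P u) ?_
        hna ha cna ⟨cna, hPa⟩).2
      rintro u hu ⟨hcu, hPu⟩
      refine ⟨(h.comp_next u hu).trans hcu, ?_⟩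
      rw [← vo u ?_ ?_ ?_ ?_]
      · exact (hP u hu).1 hPu
      · rintro rfl; exact hne (by rw [← hc, hcu])
      · rintro rfl; exact hcon hPu
      · rintro rfl; exact hne hcu
      · rintro rfl; exact hne (by rw [← cpy, hcu])
    -- The same for the other cycle, from `prev y` to `x`. The vertex `y` is exempted since it is
    -- bypassed there, and the lost step `x → next x` is replaced by the detour through `next a`,
    -- `a` and `y`.
    have key2 : ∀ P : ℕ → Prop, (∀ u < n, P u ↔ P (mergeNext next prev a x y u)) →
        (P (prev y) → P x) := by
      intro P hP hPp
      have hxn : P x → P (next x) := by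
        intro hPx
        have h1 := (hP x hx).1 hPx
        rw [vx] at h1
        have h2 := (hP a ha).1 (key P hP h1)
        rw [va] at h2
        have h3 := (hP y hy).1 h2
        rwa [vy] at h3
      have := (h.conn_of_next
        (P := fun u => comp (cell u) = comp (cell y) ∧ (P u ∨ u = y)) ?_
        hpy hx (by rw [cpy, hc]) ⟨by rw [cpy], .inl hPp⟩).2
      · exact this.resolve_right yx.symm
      · rintro u hu ⟨hcu, hPu⟩
        refine ⟨(h.comp_next u hu).trans hcu, ?_⟩
        by_cases h1 : u = y
        · left
          have := (hP (prev y) hpy).1 hPp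
          rw [vp] at this
          rwa [h1]
        have hPu := hPu.resolve_right h1
        by_cases h2 : u = prev y
        · right; rw [h2, h.next_prev y hy]
        by_cases h3 : u = x
        · left; subst h3; exact hxn hPu
        left
        rw [← vo u h3 ?_ h1 h2]
        · exact (hP u hu).1 hPu
        · rintro rfl; exact hne hcu.symm
    -- The negation of `P` is invariant too, which turns both implications into equivalences.
    have hN : ∀ u < n, ¬ P u ↔ ¬ P (mergeNext next prev a x y u) :=
      fun u hu => not_congr (hP u hu)
    have e1 : P (next a) ↔ P a :=
      ⟨key P hP, fun q => by_contra fun q' => key (fun u => ¬ P u) hN q' q⟩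
    have e2 : P (prev y) ↔ P x :=
      ⟨key2 P hP, fun q => by_contra fun q' => key2 (fun u => ¬ P u) hN q' q⟩
    have e3 := hP x hx
    have e4 := hP a ha
    have e5 := hP y hy
    have e6 := hP (prev y) hpy
    rw [vx] at e3
    rw [va] at e4
    rw [vy] at e5
    rw [vp] at e6
    -- `P` is thus invariant under the old successor function as well. The old connectedness applies
    -- to each of the two cycles, and `P a ↔ P x` links them.
    have hold : ∀ u < n, P u ↔ P (next u) := by
      refine cases4 _ (e3.trans (e1.trans (e4.trans e5))) e1.symm
        (((e4.symm.trans e1.symm).trans e3.symm).trans (e2.symm.trans e6)) ?_ ?_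
      · rw [h.next_prev y hy]
        exact e2.trans (e3.trans (e1.trans e4))
      · intro u hu h1 h2 h3 h4
        have := hP u hu
        rwa [vo u h1 h2 h3 h4] at this
    have hax : P a ↔ P x := e1.symm.trans e3.symm
    intro u hu v hv huv
    have hc' := h.conn P hold
    simp only [mergeComp, hcell u hu, hcell v hv, true_and] at huv
    split_ifs at huv with h1 h2 h2
    · exact hc' u hu v hv (h1.trans h2.symm)
    · rw [hc' u hu a ha h1, hax, hc' x hx v hv huv]
    · rw [hc' u hu x hx huv, ← hax, hc' a ha v hv h2.symm]
    · exact hc' u hu v hv huv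

/-- Adding the vertex `i` in a new cell to a cover of the vertices below `i`. -/
theorem CycleCover.addNew {i : ℕ} (h : CycleCover i E cell next prev used id)
    (hnew : ∀ u < i, cell u ≠ cell i) :
    CycleCover (i + 1) E cell (Function.update next i i) (Function.update prev i i) used id := by
  have vo : ∀ f : ℕ → ℕ, ∀ u < i, Function.update f i i u = f u := fun f u hu => by
    simp [Function.update, hu.ne]
  have ext : ∀ Q : ℕ → Prop, (∀ u < i, Q u) → Q i → ∀ u < i + 1, Q u := by
    intro Q q1 q2 u hu
    rcases Nat.lt_succ_iff_lt_or_eq.1 hu with hu | rfl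
    exacts [q1 u hu, q2]
  refine ⟨?_, ?_, ?_, ?_, ?_, ?_, ?_, ?_, ?_⟩
  · exact ext _ (fun u hu => by rw [vo _ u hu]; have := h.next_lt u hu; omega) (by simp)
  · exact ext _ (fun u hu => by rw [vo _ u hu]; have := h.prev_lt u hu; omega) (by simp)
  · exact ext _ (fun u hu => by rw [vo _ u hu, vo _ _ (h.next_lt u hu), h.prev_next u hu])
      (by simp)
  · exact ext _ (fun u hu => by rw [vo _ u hu, vo _ _ (h.prev_lt u hu), h.next_prev u hu])
      (by simp)
  · exact ext _ (fun u hu => by rw [vo _ u hu]; exact h.step u hu) (by simp)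
  · exact ext _ (fun u hu => by rw [vo _ u hu]; exact h.cell_next u hu) (by simp)
  · exact ext _ (fun u hu => by rw [vo _ u hu]; exact h.cell_prev u hu) (by simp)
  · exact ext _ (fun u hu => by rw [vo _ u hu]; exact h.comp_next u hu) (by simp)
  · intro P hP
    have hold : ∀ u < i, P u ↔ P (next u) := fun u hu => by
      have := hP u (by omega)
      rwa [vo _ u hu] at this
    refine ext _ (fun u hu => ext _ (fun v hv huv => h.conn P hold u hu v hv huv)
      fun e => absurd e (hnew u hu)) (ext _ (fun v hv e => absurd e.symm (hnew v hv)) (by simp))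

/-- Adding the vertex `i` to a cover of the vertices below `i`, after a vertex `f` of its cell. -/
theorem CycleCover.addAfter {i f : ℕ} (h : CycleCover i E cell next prev used id)
    (hf : f < i) (hcf : cell f = cell i) (hused : ∀ u < i, used u = 0) :
    CycleCover (i + 1) E cell (Function.update (Function.update next i (next f)) f i)
      (Function.update (Function.update prev (next f) i) i f) used id := by
  have hnf := h.next_lt f hf
  set nx := Function.update (Function.update next i (next f)) f i with hnx
  set pv := Function.update (Function.update prev (next f) i) i f with hpv
  have vi : nx i = next f := by simp [hnx, Function.update, hf.ne']
  have vf : nx f = i := by simp [hnx]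
  have vo : ∀ u < i, u ≠ f → nx u = next u := fun u hu h1 => by
    simp [hnx, Function.update, h1, hu.ne]
  have wi : pv i = f := by simp [hpv]
  have wf : pv (next f) = i := by simp [hpv, Function.update, hnf.ne]
  have wo : ∀ u < i, u ≠ next f → pv u = prev u := fun u hu h1 => by
    simp [hpv, Function.update, h1, hu.ne]
  have cn : ∀ u < i, cell (next u) = cell u := fun u hu => h.cell_next u hu (hused u hu)
  have cp : ∀ u < i, cell (prev u) = cell u := fun u hu => h.cell_prev u hu (hused u hu)
  have ext : ∀ Q : ℕ → Prop, (∀ u < i, u ≠ f → Q u) → Q f → Q i → ∀ u < i + 1, Q u := by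
    intro Q q1 q2 q3 u hu
    rcases Nat.lt_succ_iff_lt_or_eq.1 hu with hu | rfl
    · by_cases e : u = f
      exacts [e ▸ q2, q1 u hu e]
    · exact q3
  have ext' : ∀ Q : ℕ → Prop, (∀ u < i, u ≠ next f → Q u) → Q (next f) → Q i →
      ∀ u < i + 1, Q u := by
    intro Q q1 q2 q3 u hu
    rcases Nat.lt_succ_iff_lt_or_eq.1 hu with hu | rfl
    · by_cases e : u = next f
      exacts [e ▸ q2, q1 u hu e]
    · exact q3
  have cnx : ∀ u < i + 1, cell (nx u) = cell u :=
    ext _ (fun u hu e => by rw [vo u hu e, cn u hu]) (by rw [vf, hcf]) (by rw [vi, cn f hf, hcf])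
  have cpv : ∀ u < i + 1, cell (pv u) = cell u :=
    ext' _ (fun u hu e => by rw [wo u hu e, cp u hu]) (by rw [wf, cn f hf, hcf]) (by rw [wi, hcf])
  refine ⟨?_, ?_, ?_, ?_, ?_, ?_, ?_, ?_, ?_⟩
  · exact ext _ (fun u hu e => by rw [vo u hu e]; have := h.next_lt u hu; omega)
      (by rw [vf]; omega) (by rw [vi]; omega)
  · exact ext' _ (fun u hu e => by rw [wo u hu e]; have := h.prev_lt u hu; omega)
      (by rw [wf]; omega) (by rw [wi]; omega)
  · refine ext _ (fun u hu e => ?_) (by rw [vf, wi]) (by rw [vi, wf])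
    rw [vo u hu e, wo _ (h.next_lt u hu), h.prev_next u hu]
    intro e'
    exact e (by rw [← h.prev_next u hu, e', h.prev_next f hf])
  · refine ext' _ (fun u hu e => ?_) (by rw [wf, vi]) (by rw [wi, vf])
    rw [wo u hu e, vo _ (h.prev_lt u hu), h.next_prev u hu]
    intro e'
    exact e (by rw [← e', h.next_prev u hu])
  · exact fun u hu => .inr (cnx u hu).symm
  · exact fun u hu _ => cnx u hu
  · exact fun u hu _ => cpv u hu
  · exact fun u hu => cnx u hu
  · intro P hP
    have e1 := hP f (by omega)
    have e2 := hP i (by omega)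
    rw [vf] at e1
    rw [vi] at e2
    have hold : ∀ u < i, P u ↔ P (next u) := fun u hu => by
      by_cases e : u = f
      · rw [e]; exact e1.trans e2
      · have := hP u (by omega)
        rwa [vo u hu e] at this
    have hc := h.conn P hold
    have conn' : ∀ u < i, cell u = cell i → (P u ↔ P i) := fun u hu e => by
      rw [← e1]; exact hc u hu f hf (e.trans hcf.symm)
    intro u hu v hv huv
    rcases Nat.lt_succ_iff_lt_or_eq.1 hu with hu | rfl <;>
      rcases Nat.lt_succ_iff_lt_or_eq.1 hv with hv | rfl
    · exact hc u hu v hv huv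
    · exact conn' u hu huv
    · exact (conn' v hv huv.symm).symm
    · rfl

/-- If all labels agree, then iterating `next` visits all vertices within `n` steps. -/
theorem CycleCover.exists_iterate (h : CycleCover n E cell next prev used comp) (hn : 0 < n)
    (hcomp : ∀ u < n, ∀ v < n, comp (cell u) = comp (cell v)) :
    ∀ u < n, ∃ i < n, next^[i] 0 = u := by
  classical
  have hlt : ∀ i, next^[i] 0 < n := by
    intro i
    induction i with
    | zero => exact hn
    | succ i ih => rw [Function.iterate_succ_apply']; exact h.next_lt _ ih
  let T : ℕ → Finset ℕ := fun k => (Finset.range k).image fun i => next^[i] 0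
  have hTsucc : ∀ k, T (k + 1) = insert (next^[k] 0) (T k) := fun k => by
    simp [T, Finset.range_add_one]
  have hTn : ∀ k, T k ⊆ Finset.range n := fun k w hw => by
    obtain ⟨i, -, rfl⟩ := Finset.mem_image.1 hw
    simpa using hlt i
  -- A further iterate is either new or makes the visited set closed under `next`. A closed set
  -- contains all vertices, since all labels agree.
  have main : ∀ k, T (k + 1) = Finset.range n ∨ (T (k + 1)).card = k + 1 := by
    intro k
    induction k with
    | zero => right; simp [T]
    | succ k ih =>
      by_cases hmem : next^[k + 1] 0 ∈ T (k + 1)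
      · left
        have hcl : ∀ u < n, u ∈ T (k + 1) → next u ∈ T (k + 1) := by
          intro u _ hu
          obtain ⟨i, hi, rfl⟩ := Finset.mem_image.1 hu
          rw [Finset.mem_range] at hi
          rw [← Function.iterate_succ_apply' next]
          rcases Nat.lt_succ_iff_lt_or_eq.1 hi with hi | rfl
          · exact Finset.mem_image.2 ⟨i + 1, by simpa using hi, rfl⟩
          · exact hmem
        have hall : T (k + 1) = Finset.range n := by
          refine Finset.Subset.antisymm (hTn _) fun v hv => ?_
          exact h.conn_of_next hcl hn (Finset.mem_range.1 hv)
            (hcomp _ hn _ (Finset.mem_range.1 hv))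
            (Finset.mem_image.2 ⟨0, by simp, rfl⟩)
        rw [hTsucc, Finset.insert_eq_of_mem hmem, hall]
      · rw [hTsucc, Finset.card_insert_of_notMem hmem]
        rcases ih with ih | ih
        · exact absurd (by rw [ih]; simpa using hlt (k + 1)) hmem
        · right; rw [ih]
  obtain ⟨k, rfl⟩ : ∃ k, n = k + 1 := ⟨n - 1, by omega⟩
  have hT : T (k + 1) = Finset.range (k + 1) := by
    rcases main k with e | e
    · exact e
    · exact Finset.eq_of_subset_of_card_le (hTn _) (by rw [e]; simp)
  intro u hu
  have : u ∈ T (k + 1) := by rw [hT]; simpa using hu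
  obtain ⟨i, hi, e⟩ := Finset.mem_image.1 this
  exact ⟨i, by simpa using hi, e⟩

/-! ### Progress of the merging procedure -/

open Classical in
/-- Every vertex has at least `20` neighbours in most of the `N` cells. -/
structure WellSpread (n N : ℕ) (E : ℕ → ℕ → Prop) (cell : ℕ → ℕ) : Prop where
  pos : 0 < N
  cell_lt : ∀ u < n, cell u < N
  sparse : ∀ v < n, 9 * ((Finset.range N).filter fun q =>
    ((Finset.range n).filter fun u => E v u ∧ cell u = q).card < 20).card ≤ N

theorem WellSpread.congr {N : ℕ} {cell' : ℕ → ℕ} (h : WellSpread n N E cell)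
    (hc : ∀ u < n, cell' u = cell u) : WellSpread n N E cell' where
  pos := h.pos
  cell_lt u hu := by rw [hc u hu]; exact h.cell_lt u hu
  sparse v hv := by
    classical
    refine le_of_eq_of_le ?_ (h.sparse v hv)
    congr 2
    refine Finset.filter_congr fun q _ => ?_
    rw [Finset.filter_congr fun u hu => by rw [hc u (Finset.mem_range.1 hu)]]

/-- More than half of the `N` cells have the label `k`. -/
def MajorLabel (N : ℕ) (comp : ℕ → ℕ) (k : ℕ) : Prop :=
  N < 2 * ((Finset.range N).filter fun q => comp q = k).card

/-- Two disjoint majorities do not fit into `N` cells. -/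
theorem MajorLabel.unique {N : ℕ} {comp : ℕ → ℕ} {k l : ℕ} (hk : MajorLabel N comp k)
    (hl : MajorLabel N comp l) : k = l := by
  unfold MajorLabel at hk hl
  by_contra hne
  have hd : Disjoint ((Finset.range N).filter fun q => comp q = k)
      ((Finset.range N).filter fun q => comp q = l) := by
    rw [Finset.disjoint_filter]
    rintro q - rfl
    exact hne
  have := Finset.card_le_card (Finset.union_subset (Finset.filter_subset (fun q => comp q = k) _)
    (Finset.filter_subset (fun q => comp q = l) (Finset.range N)))
  rw [Finset.card_union_of_disjoint hd, Finset.card_range] at this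
  omega

/-- The state of the merging procedure when the cells below `c` have been processed: few vertices
are used, and every label that is not a major one belongs to some vertex whose cell has not been
processed. -/
structure Progress (n N : ℕ) (cell used comp : ℕ → ℕ) (c : ℕ) : Prop where
  used_le : ((Finset.range n).filter fun u => used u ≠ 0).card ≤ 4 * min c N
  label : ∀ u < n, MajorLabel N comp (comp (cell u)) ∨
    ∃ w < n, c ≤ cell w ∧ comp (cell w) = comp (cell u)

variable {N c : ℕ}

/-- If no merge is possible for `a`, then the label of `a` is a major one. -/
theorem WellSpread.majorLabel (hs : WellSpread n N E cell)
    (hused : ((Finset.range n).filter fun u => used u ≠ 0).card ≤ 4 * N)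
    {a b : ℕ} (ha : a < n) (hb : b < n)
    (hfail : ∀ q < N, comp q ≠ comp (cell a) →
      (∀ v < n, E b v → used v = 0 → cell v ≠ q) ∨
      ∃ s t, ∀ v < n, E a v → used v = 0 → cell v = q → v = s ∨ v = t) :
    MajorLabel N comp (comp (cell a)) := by
  classical
  -- The cells outside `M`, the cells labelled like `a`, are covered by `A`, `B` and `D`. These have
  -- at most `N / 9`, `N / 9` and `4 * N / 17` elements, and `2 / 9 + 4 / 17 = 70 / 153 < 1 / 2`.
  set A := (Finset.range N).filter fun q =>
    ((Finset.range n).filter fun u => E a u ∧ cell u = q).card < 20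
  set B := (Finset.range N).filter fun q =>
    ((Finset.range n).filter fun u => E b u ∧ cell u = q).card < 20
  set U := (Finset.range n).filter fun u => used u ≠ 0
  set D := (Finset.range N).filter fun q => 17 ≤ (U.filter fun u => cell u = q).card
  set M := (Finset.range N).filter fun q => comp q = comp (cell a)
  have hA : 9 * A.card ≤ N := hs.sparse a ha
  have hB : 9 * B.card ≤ N := hs.sparse b hb
  have hD : D.card * 17 ≤ 4 * N := by
    have h1 : D.card * 17 ≤ ∑ q ∈ D, (U.filter fun u => cell u = q).card := by
      rw [← smul_eq_mul]
      exact Finset.card_nsmul_le_sum _ _ _ fun q hq => (Finset.mem_filter.1 hq).2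
    have h2 : ∑ q ∈ D, (U.filter fun u => cell u = q).card ≤
        ∑ q ∈ Finset.range N, (U.filter fun u => cell u = q).card :=
      Finset.sum_le_sum_of_subset (Finset.filter_subset _ _)
    have h3 : ∑ q ∈ Finset.range N, (U.filter fun u => cell u = q).card = U.card := by
      refine (Finset.card_eq_sum_card_fiberwise fun u hu => ?_).symm
      have := (Finset.mem_filter.1 (Finset.mem_coe.1 hu)).1
      simpa using hs.cell_lt u (Finset.mem_range.1 this)
    omega
  have hcov : Finset.range N ⊆ A ∪ B ∪ D ∪ M := by
    intro q hq
    by_contra hcon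
    simp only [Finset.mem_union, not_or] at hcon
    obtain ⟨⟨⟨qA, qB⟩, qD⟩, qM⟩ := hcon
    have qM' : comp q ≠ comp (cell a) := fun e => qM (Finset.mem_filter.2 ⟨hq, e⟩)
    have qA' : 20 ≤ ((Finset.range n).filter fun u => E a u ∧ cell u = q).card :=
      not_lt.1 fun e => qA (Finset.mem_filter.2 ⟨hq, e⟩)
    have qB' : 20 ≤ ((Finset.range n).filter fun u => E b u ∧ cell u = q).card :=
      not_lt.1 fun e => qB (Finset.mem_filter.2 ⟨hq, e⟩)
    have qD' : (U.filter fun u => cell u = q).card < 17 :=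
      not_le.1 fun e => qD (Finset.mem_filter.2 ⟨hq, e⟩)
    -- Of at least 20 neighbours in `q` at most 16 are used and at most two more are the exceptions
    -- `s` and `t`, so both alternatives are contradictory.
    rcases hfail q (Finset.mem_range.1 hq) qM' with hf | ⟨s, t, hf⟩
    · have : ((Finset.range n).filter fun u => E b u ∧ cell u = q) ⊆
          U.filter fun u => cell u = q := by
        intro u hu
        obtain ⟨hu, hEu, hcu⟩ := Finset.mem_filter.1 hu
        refine Finset.mem_filter.2 ⟨Finset.mem_filter.2 ⟨hu, fun e => ?_⟩, hcu⟩
        exact hf u (Finset.mem_range.1 hu) hEu e hcu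
      have := Finset.card_le_card this
      omega
    · have : ((Finset.range n).filter fun u => E a u ∧ cell u = q) ⊆
          (U.filter fun u => cell u = q) ∪ {s, t} := by
        intro u hu
        obtain ⟨hu, hEu, hcu⟩ := Finset.mem_filter.1 hu
        by_cases e : used u = 0
        · have := hf u (Finset.mem_range.1 hu) hEu e hcu
          exact Finset.mem_union_right _ (by simpa using this)
        · exact Finset.mem_union_left _
            (Finset.mem_filter.2 ⟨Finset.mem_filter.2 ⟨hu, e⟩, hcu⟩)
      have h1 := Finset.card_le_card this
      have h2 := Finset.card_union_le (U.filter fun u => cell u = q) {s, t}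
      have h3 := Finset.card_le_two (a := s) (b := t)
      omega
  have hcard := Finset.card_le_card hcov
  rw [Finset.card_range] at hcard
  have h1 := Finset.card_union_le (A ∪ B ∪ D) M
  have h2 := Finset.card_union_le (A ∪ B) D
  have h3 := Finset.card_union_le A B
  have := hs.pos
  change N < 2 * M.card
  omega

/-- The only witnesses lost are vertices of the cell `c` itself, and their label is major by
assumption; for an empty cell nothing is lost. -/
theorem Progress.skip (h : Progress n N cell used comp c)
    (hmaj : ∀ u < n, cell u = c → MajorLabel N comp (comp c)) :
    Progress n N cell used comp (c + 1) := by
  refine ⟨h.used_le.trans (by omega), fun u hu => ?_⟩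
  rcases h.label u hu with hl | ⟨w, hw, hcw, e⟩
  · exact .inl hl
  · rcases hcw.eq_or_lt with rfl | hlt
    · left; rw [← e]; exact hmaj w hw rfl
    · exact .inr ⟨w, hw, hlt, e⟩

/-- The merged cycle takes over the label of `x`, so the label of `a` disappears and needs no
witness. A witness for any other label has a label different from that of the cell `c`, so its cell
lies beyond `c`; and a major label only gains cells. -/
theorem Progress.merge (h : Progress n N cell used comp c) (hcell : ∀ u < n, cell u < n)
    (hN : ∀ u < n, cell u < N) {a x y : ℕ} (hca : cell a = c)
    (m : Mergeable n E cell next prev used comp a x y) :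
    Progress n N cell (mergeUsed used next a x y)
      (mergeComp n comp (comp (cell a)) (comp (cell x))) (c + 1) := by
  obtain ⟨ha, hx, hy, -, -, -, -, hc, hne, -, -⟩ := m
  rw [← hc] at hne
  constructor
  · have hsub : ((Finset.range n).filter fun u => mergeUsed used next a x y u ≠ 0) ⊆
        ((Finset.range n).filter fun u => used u ≠ 0) ∪ {a, next a, x, y} := by
      intro u hu
      obtain ⟨hu, hne⟩ := Finset.mem_filter.1 hu
      by_contra hcon
      simp only [Finset.mem_union, Finset.mem_filter, Finset.mem_insert, Finset.mem_singleton,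
        not_or, not_and, not_not] at hcon
      obtain ⟨h0, h1, h2, h3, h4⟩ := hcon
      exact hne (by simp [mergeUsed, Function.update, h1, h2, h3, h4, h0 hu])
    have h1 := Finset.card_le_card hsub
    have h2 := Finset.card_union_le ((Finset.range n).filter fun u => used u ≠ 0) {a, next a, x, y}
    have h3 := Finset.card_le_four (a := a) (b := next a) (c := x) (d := y)
    have h4 := h.used_le
    have := hN a ha
    omega
  · have keep : ∀ k, k ≠ comp (cell a) → MajorLabel N comp k →
        MajorLabel N (mergeComp n comp (comp (cell a)) (comp (cell x))) k := by
      intro k hk hm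
      refine lt_of_lt_of_le hm (Nat.mul_le_mul_left 2 (Finset.card_le_card ?_))
      intro q hq
      obtain ⟨hq, e⟩ := Finset.mem_filter.1 hq
      refine Finset.mem_filter.2 ⟨hq, ?_⟩
      simp [mergeComp, e, hk]
    have val : ∀ u, comp (cell u) ≠ comp (cell a) →
        mergeComp n comp (comp (cell a)) (comp (cell x)) (cell u) = comp (cell u) := by
      intro u hu
      simp [mergeComp, hu]
    have main : ∀ u < n, comp (cell u) ≠ comp (cell a) →
        MajorLabel N (mergeComp n comp (comp (cell a)) (comp (cell x))) (comp (cell u)) ∨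
        ∃ w < n, c + 1 ≤ cell w ∧
          mergeComp n comp (comp (cell a)) (comp (cell x)) (cell w) = comp (cell u) := by
      intro u hu hua
      rcases h.label u hu with hl | ⟨w, hw, hcw, e⟩
      · exact .inl (keep _ hua hl)
      · refine .inr ⟨w, hw, ?_, by rw [val w (by rw [e]; exact hua), e]⟩
        refine lt_of_le_of_ne hcw fun e' => hua ?_
        rw [← e, ← e', hca]
    intro u hu
    by_cases hua : comp (cell u) = comp (cell a)
    · have : mergeComp n comp (comp (cell a)) (comp (cell x)) (cell u) = comp (cell x) := by
        simp [mergeComp, hcell u hu, hua]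
      rw [this]
      exact main x hx hne
    · rw [val u hua]
      exact main u hu hua

/-- Once all cells are processed no witness remains, so every label is major. -/
theorem Progress.comp_eq (h : Progress n N cell used comp n) (hcell : ∀ u < n, cell u < n) :
    ∀ u < n, ∀ v < n, comp (cell u) = comp (cell v) := by
  have hm : ∀ u < n, MajorLabel N comp (comp (cell u)) := fun u hu =>
    (h.label u hu).resolve_right (by
      rintro ⟨w, hw, hcw, -⟩
      exact absurd (hcell w hw) (by omega))
  exact fun u hu v hv => (hm u hu).unique (hm v hv)

theorem Progress.init (hN : ∀ q, used q = 0) : Progress n N cell used comp 0 :=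
  ⟨by simp [hN], fun u hu => .inr ⟨u, hu, by omega, rfl⟩⟩

end cover

/-! ### The algorithm: cells -/

section cells

variable {d n : ℕ} {I : Input d n} {W : ℕ}

/-- Powers of an expression. -/
def NatExpr.pow (e : NatExpr) : ℕ → NatExpr
  | 0 => .const 1
  | k + 1 => .mul (e.pow k) e

@[simp] theorem NatExpr.eval_pow (σ : Store) (e : NatExpr) (k : ℕ) :
    (e.pow k).eval I σ = e.eval I σ ^ k := by
  induction k with
  | zero => rfl
  | succ k ih => simp [NatExpr.pow, ih, pow_succ]

/-- Compute the largest `m` with `L * m ^ d ≤ n`. -/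
def gridProgram (d L : ℕ) : Program :=
  .loop (.natLe (.mul (.const L) ((NatExpr.add (scalar 20) (.const 1)).pow d)) .size)
    (.setNat 20 (.const 0) (.add (scalar 20) (.const 1)))

theorem runs_gridProgram {L : ℕ} (hd : 1 ≤ d) (hL : 1 ≤ L) (hW : n ≤ W) :
    Runs I W (gridProgram d L) Store.init (n * 2 + 1) (fun τ => ∃ m, (m = 0 ∨ L * m ^ d ≤ n) ∧
      n < L * (m + 1) ^ d ∧ τ.nat 20 0 = m ∧ ∀ b, b ≠ 20 → τ.nat b = fun _ => 0) := by
  refine Runs.loop (T := 1) (M := n)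
    (Inv := fun m τ => (m = 0 ∨ L * m ^ d ≤ n) ∧ τ.nat 20 0 = m ∧ ∀ b, b ≠ 20 → τ.nat b = fun _ => 0)
    ?_ ?_ n 0 Store.init (by omega) ⟨.inl rfl, rfl, fun _ _ => rfl⟩
  · rintro m τ ⟨h1, h2, h3⟩ hb
    have hle : L * (m + 1) ^ d ≤ n := by simpa [Test.Holds, h2] using hb
    have : m + 1 ≤ n := calc
      m + 1 ≤ (m + 1) ^ d := Nat.le_self_pow (by omega) _
      _ ≤ L * (m + 1) ^ d := Nat.le_mul_of_pos_left _ hL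
      _ ≤ n := hle
    refine ⟨this, Runs.setNat (by simp [h2]; omega) ⟨.inr hle, by simp [h2], ?_⟩⟩
    intro b hb
    simp [hb, h3 b hb]
  · rintro m τ ⟨h1, h2, h3⟩ hb
    have hle : ¬ L * (m + 1) ^ d ≤ n := by simpa [Test.Holds, h2] using hb
    exact ⟨m, h1, by omega, h2, h3⟩

/-- The index of the interval of length `1 / m` that contains `t`. -/
noncomputable def digit (m : ℕ) (t : ℝ) : ℕ := min ⌊m * t⌋₊ (m - 1)

/-- The coordinates of the input points, for vertices and coordinates named by natural numbers. -/
noncomputable def Input.coordN (I : Input d n) (u k : ℕ) : ℝ :=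
  if h : u < n ∧ k < d then I.pos ⟨u, h.1⟩ ⟨k, h.2⟩ else 0

/-- The cell of a vertex in the grid with `m ^ d` cells. -/
noncomputable def Input.cellN (I : Input d n) (m u : ℕ) : ℕ :=
  ∑ k ∈ Finset.range d, digit m (I.coordN u k) * m ^ k

/-- An expansion in base `m` with `K` digits. -/
theorem sum_digit_lt {m : ℕ} (hm : 1 ≤ m) (t : ℕ → ℝ) (K : ℕ) :
    ∑ k ∈ Finset.range K, digit m (t k) * m ^ k < m ^ K := by
  induction K with
  | zero => simp
  | succ K ih =>
    rw [Finset.sum_range_succ]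
    have h1 : digit m (t K) ≤ m - 1 := min_le_right _ _
    have h2 : digit m (t K) * m ^ K ≤ (m - 1) * m ^ K := Nat.mul_le_mul_right _ h1
    have h3 : m ^ (K + 1) = m ^ K + (m - 1) * m ^ K := by
      obtain ⟨l, rfl⟩ : ∃ l, m = l + 1 := ⟨m - 1, by omega⟩
      simp only [Nat.add_sub_cancel]
      ring
    omega

/-- Partial sums are included because they are stored on the way and have to respect the word bound.
-/
theorem sum_digit_le {m L : ℕ} (hL : 1 ≤ L) (hm : m = 0 ∨ L * m ^ d ≤ n) (t : ℕ → ℝ)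
    {K : ℕ} (hK : K ≤ d) : ∑ k ∈ Finset.range K, digit m (t k) * m ^ k ≤ n := by
  rcases Nat.eq_zero_or_pos m with rfl | hpos
  · simp [digit]
  · refine (sum_digit_lt hpos t K).le.trans ((Nat.pow_le_pow_right hpos hK).trans ?_)
    rcases hm with rfl | hm
    · omega
    · exact (Nat.le_mul_of_pos_left _ hL).trans hm

/-- The value `m = 0` occurs for `n < L`; all digits then vanish and there is one cell. -/
theorem Input.cellN_lt {m L : ℕ} (I : Input d n) (hL : 1 ≤ L)
    (hm : m = 0 ∨ L * m ^ d ≤ n) {u : ℕ} (hu : u < n) : I.cellN m u < n := by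
  rcases Nat.eq_zero_or_pos m with rfl | hpos
  · have : I.cellN 0 u = 0 := by simp [Input.cellN, digit]
    omega
  · refine (sum_digit_lt hpos (I.coordN u) d).trans_le ?_
    rcases hm with rfl | hm
    · omega
    · exact (Nat.le_mul_of_pos_left _ hL).trans hm

/-- Add the contribution of the `k`-th coordinate to the cell index of the current vertex. -/
def digitProgram (k : ℕ) : Program :=
  .seq (.setNat 21 (.const 0) (.const 0))
  (.seq (.loop (.and (.natLe (.add (scalar 21) (.const 2)) (scalar 20))
      (.realLe (.ofNat (.add (scalar 21) (.const 1)))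
        (.mul (.ofNat (scalar 20)) (.coord (scalar 22) (.const k)))))
      (.setNat 21 (.const 0) (.add (scalar 21) (.const 1))))
    (.setNat 4 (scalar 22)
      (.add (.get 4 (scalar 22)) (.mul (scalar 21) ((scalar 20).pow k)))))

theorem runs_digitProgram {m u k : ℕ} {τ : Store} (hW : n ≤ W) (hm : m ≤ n)
    (h20 : τ.nat 20 0 = m) (h22 : τ.nat 22 0 = u)
    (hle : τ.nat 4 u + digit m (I.coordN u k) * m ^ k ≤ n) :
    Runs I W (digitProgram k) τ (n * 2 + 3) (fun υ =>
      υ.nat 4 = Function.update (τ.nat 4) u (τ.nat 4 u + digit m (I.coordN u k) * m ^ k) ∧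
      ∀ b, b ≠ 4 → b ≠ 21 → υ.nat b = τ.nat b) := by
  set D := digit m (I.coordN u k) with hD
  have hD1 : D ≤ m - 1 := min_le_right _ _
  -- Without rounding, the floor is found by counting up. The bound `j + 2 ≤ m` is the cap `m - 1`
  -- of `digit`, which puts `t = 1` into the last interval. As `j + 1` is not zero, the criterion
  -- for the floor also holds for negative coordinates.
  have hiff : ∀ j, (j + 1 ≤ D ↔ j + 2 ≤ m ∧ ((j + 1 : ℕ) : ℝ) ≤ m * I.coordN u k) := by
    intro j
    rw [hD, digit, le_min_iff, Nat.le_floor_iff' (by omega), and_comm]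
    refine and_congr_left' ?_
    omega
  have hloop := Runs.loop (I := I) (W := W)
    (b := .and (.natLe (.add (scalar 21) (.const 2)) (scalar 20))
      (.realLe (.ofNat (.add (scalar 21) (.const 1)))
        (.mul (.ofNat (scalar 20)) (.coord (scalar 22) (.const k)))))
    (p := .setNat 21 (.const 0) (.add (scalar 21) (.const 1))) (T := 1) (M := n)
    (Inv := fun j υ => j ≤ D ∧ υ.nat 21 0 = j ∧ ∀ b, b ≠ 21 → υ.nat b = τ.nat b)
    (Q := fun υ => υ.nat 21 0 = D ∧ ∀ b, b ≠ 21 → υ.nat b = τ.nat b)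
    (by
      rintro j υ ⟨h1, h2, h3⟩ hb
      have hb' : j + 1 ≤ D := by
        rw [hiff]
        simpa [Test.Holds, RealExpr.eval, h2, h3, h20, h22, Input.coordN] using hb
      refine ⟨by omega, Runs.setNat (by simp [h2]; omega) ⟨hb', by simp [h2], ?_⟩⟩
      intro b hb
      simp [hb, h3 b hb])
    (by
      rintro j υ ⟨h1, h2, h3⟩ hb
      have hb' : ¬ j + 1 ≤ D := by
        rw [hiff]
        simpa [Test.Holds, RealExpr.eval, h2, h3, h20, h22, Input.coordN] using hb
      exact ⟨by omega, h3⟩)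
    n 0 (τ.setNat 21 0 0) (by omega)
    ⟨Nat.zero_le _, by simp, fun b hb => by simp [hb]⟩
  refine (Runs.setNat_seq (by simp) (Runs.seq hloop (T := 1) ?_)).mono (by omega) (fun _ h => h)
  rintro υ ⟨h1, h2⟩
  refine Runs.setNat (by simpa [h1, h2, h20, h22] using hle.trans hW) ⟨?_, ?_⟩
  · simp [h1, h2, h20, h22]
  · intro b hb hb'
    simp [hb, h2 b hb']

/-- Compute the cell index of the current vertex. -/
def cellProgram : ℕ → Program
  | 0 => .skip
  | k + 1 => .seq (cellProgram k) (digitProgram k)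

theorem runs_cellProgram {m L u : ℕ} {τ : Store} (hW : n ≤ W) (hm : m ≤ n) (hL : 1 ≤ L)
    (hmL : m = 0 ∨ L * m ^ d ≤ n) (h20 : τ.nat 20 0 = m) (h22 : τ.nat 22 0 = u)
    (h4 : τ.nat 4 u = 0) {K : ℕ} (hK : K ≤ d) :
    Runs I W (cellProgram K) τ (K * (n * 2 + 3) + 1) (fun υ =>
      υ.nat 4 = Function.update (τ.nat 4) u
        (∑ k ∈ Finset.range K, digit m (I.coordN u k) * m ^ k) ∧
      ∀ b, b ≠ 4 → b ≠ 21 → υ.nat b = τ.nat b) := by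
  induction K with
  | zero =>
    refine (Runs.skip ⟨?_, fun _ _ _ => rfl⟩).mono (by omega) (fun _ h => h)
    simp [h4]
  | succ K ih =>
    refine (Runs.seq (ih (by omega)) (T := n * 2 + 3) ?_).mono (le_of_eq (by ring)) (fun _ h => h)
    rintro υ ⟨h1, h2⟩
    have hle := sum_digit_le hL hmL (I.coordN u) hK
    rw [Finset.sum_range_succ] at hle
    refine (runs_digitProgram (u := u) hW hm (by rw [h2 20 (by simp) (by simp), h20])
      (by rw [h2 22 (by simp) (by simp), h22]) (by simpa [h1] using hle)).mono le_rfl ?_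
    rintro ω ⟨h3, h5⟩
    refine ⟨?_, fun b hb hb' => by rw [h5 b hb hb', h2 b hb hb']⟩
    rw [h3, h1, Finset.sum_range_succ]
    simp

theorem runs_cells {m L : ℕ} {σ : Store} (hW : n ≤ W) (hm : m ≤ n) (hL : 1 ≤ L)
    (hmL : m = 0 ∨ L * m ^ d ≤ n) (h20 : σ.nat 20 0 = m)
    (h0 : ∀ b, b ≠ 20 → σ.nat b = fun _ => 0) :
    Runs I W (.forN 22 (cellProgram d)) σ (n * (d * (n * 2 + 3) + 3) + 2) (fun τ =>
      (∀ u < n, τ.nat 4 u = I.cellN m u) ∧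
      ∀ b, b ≠ 4 → b ≠ 20 → b ≠ 21 → b ≠ 22 → τ.nat b = fun _ => 0) := by
  refine (Runs.forN (c := 22) (T := d * (n * 2 + 3) + 1) (fun i τ =>
    (∀ u < i, τ.nat 4 u = I.cellN m u) ∧ (∀ u, i ≤ u → τ.nat 4 u = 0) ∧ τ.nat 20 0 = m ∧
      ∀ b, b ≠ 4 → b ≠ 20 → b ≠ 21 → b ≠ 22 → τ.nat b = fun _ => 0) hW ?_ ?_ ?_).mono
    le_rfl ?_
  · rintro i τ v ⟨h1, h2, h3, h4⟩
    exact ⟨by simpa using h1, by simpa using h2, by simpa using h3,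
      fun b b1 b2 b3 b4 => by simpa [b4] using h4 b b1 b2 b3 b4⟩
  · refine ⟨by simp, by simp [h0], h20, fun b _ hb _ _ => h0 b hb⟩
  · rintro i τ hi hc ⟨h1, h2, h3, h4⟩
    refine (runs_cellProgram hW hm hL hmL h3 hc (h2 i le_rfl) le_rfl).mono le_rfl ?_
    rintro υ ⟨h5, h6⟩
    refine ⟨by rw [h6 22 (by simp) (by simp), hc], ?_, ?_, by rw [h6 20 (by simp) (by simp), h3], ?_⟩
    · intro u hu
      rw [h5]
      by_cases e : u = i
      · simp [e, Input.cellN]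
      · simpa [Function.update, e] using h1 u (by omega)
    · intro u hu
      rw [h5]
      simpa [Function.update, show u ≠ i by omega] using h2 u (by omega)
    · intro b b1 b2 b3 b4
      rw [h6 b b1 b3, h4 b b1 b2 b3 b4]
  · rintro τ ⟨h1, -, -, h4⟩
    exact ⟨h1, h4⟩

end cells

/-! ### The algorithm: initial cycles -/

section link

variable {d n : ℕ} {I : Input d n} {W : ℕ}

/-- Insert the current vertex into the cycle of its cell. -/
def linkProgram : Program :=
  .seq (.setNat 5 (scalar 22) (scalar 22))
  (.ite (.natEq (.get 7 (.get 4 (scalar 22))) (.const 0))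
    (.seq (.setNat 2 (scalar 22) (scalar 22))
    (.seq (.setNat 3 (scalar 22) (scalar 22))
      (.setNat 7 (.get 4 (scalar 22)) (.add (scalar 22) (.const 1)))))
    (.seq (.setNat 30 (.const 0) (.sub (.get 7 (.get 4 (scalar 22))) (.const 1)))
    (.seq (.setNat 25 (.const 0) (.get 2 (scalar 30)))
    (.seq (.setNat 2 (scalar 22) (scalar 25))
    (.seq (.setNat 3 (scalar 25) (scalar 22))
    (.seq (.setNat 2 (scalar 30) (scalar 22))
      (.setNat 3 (scalar 22) (scalar 30))))))))

/-- `head c` is `0` if the cell `c` has no vertex below `i`, and otherwise the successor of such a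
vertex. -/
def IsHead (i : ℕ) (cell head : ℕ → ℕ) : Prop :=
  ∀ c, (head c = 0 → ∀ u < i, cell u ≠ c) ∧ ∀ f, head c = f + 1 → f < i ∧ cell f = c

/-- During the construction of the initial cycles the cover carries the labels `id`, as the label
array is only partly filled; this exchanges them for the array at the end. -/
theorem CycleCover.congr_comp {E : ℕ → ℕ → Prop} {cell next prev used comp comp' : ℕ → ℕ}
    (h : CycleCover n E cell next prev used comp) (hc : ∀ u < n, comp' (cell u) = comp (cell u)) :
    CycleCover n E cell next prev used comp' where
  next_lt := h.next_lt
  prev_lt := h.prev_lt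
  prev_next := h.prev_next
  next_prev := h.next_prev
  step := h.step
  cell_next := h.cell_next
  cell_prev := h.cell_prev
  comp_next u hu := by rw [hc _ hu, hc _ (h.next_lt u hu), h.comp_next u hu]
  conn P hP u hu v hv huv := h.conn P hP u hu v hv (by rwa [hc _ hu, hc _ hv] at huv)

/-- Each vertex either opens its cell or is inserted after the vertex that opened it, so every
nonempty cell becomes one cycle. `E` is arbitrary because all steps stay inside cells. -/
theorem runs_link {σ : Store} (E : ℕ → ℕ → Prop) (hW : n + 1 ≤ W) (hcell : ∀ u < n, σ.nat 4 u < n)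
    (h0 : ∀ b, b ≠ 4 → b ≠ 20 → b ≠ 21 → b ≠ 22 → σ.nat b = fun _ => 0) :
    Runs I W (.forN 22 linkProgram) σ (n * 10 + 2) (fun τ => τ.nat 4 = σ.nat 4 ∧
      CycleCover n E (τ.nat 4) (τ.nat 2) (τ.nat 3) (τ.nat 6) (τ.nat 5) ∧
      IsHead n (τ.nat 4) (τ.nat 7) ∧ (∀ c < n, τ.nat 5 c = c) ∧ τ.nat 6 = (fun _ => 0) ∧
      τ.nat 9 = fun _ => 0) := by
  refine (Runs.forN (c := 22) (T := 8) (fun i τ => τ.nat 4 = σ.nat 4 ∧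
      CycleCover i E (τ.nat 4) (τ.nat 2) (τ.nat 3) (τ.nat 6) id ∧
      IsHead i (τ.nat 4) (τ.nat 7) ∧ (∀ c < i, τ.nat 5 c = c) ∧
      τ.nat 6 = (fun _ => 0) ∧ τ.nat 9 = fun _ => 0) (by omega) ?_ ?_ ?_).mono le_rfl ?_
  · rintro i τ v h
    simpa using h
  · refine ⟨rfl, ⟨by simp, by simp, by simp, by simp, by simp, by simp, by simp, by simp, by simp⟩,
      ?_, by simp, h0 6 (by simp) (by simp) (by simp) (by simp),
      h0 9 (by simp) (by simp) (by simp) (by simp)⟩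
    intro c
    simp [h0 7]
  · rintro i τ hi hc ⟨h4, hcov, hhead, h5, h6, h9⟩
    refine (Runs.setNat_seq (T := 7) (by simp [hc]; omega) ?_).mono le_rfl (fun _ h => h)
    refine Runs.ite ?_ ?_
    · intro hb
      have hz : τ.nat 7 (τ.nat 4 i) = 0 := by simpa [hc] using hb
      have hnew := (hhead (τ.nat 4 i)).1 hz
      refine (Runs.setNat_seq (T := 2) (by simp [hc]; omega)
        (Runs.setNat_seq (T := 1) (by simp [hc]; omega)
        (Runs.setNat (by simp [hc]; omega) ?_))).mono (by omega) (fun _ h => h)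
      refine ⟨by simp [hc], by simp [h4], ?_, ?_, ?_, by simp [h6], by simp [h9]⟩
      · simpa [hc] using hcov.addNew hnew
      · intro c
        by_cases e : c = τ.nat 4 i
        · subst e
          simp [hc]
        · have := hhead c
          simp only [hc, Nat.reduceEqDiff, if_true, if_false, NatExpr.eval_add, NatExpr.eval_get,
            NatExpr.eval_const, Store.setNat_nat, ne_eq, e, not_false_eq_true,
            Function.update_of_ne]
          refine ⟨fun hh u hu => ?_, fun f hf => ?_⟩
          · rcases Nat.lt_succ_iff_lt_or_eq.1 hu with hu | rfl
            · exact this.1 hh u hu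
            · exact fun e' => e e'.symm
          · have := this.2 f hf
            exact ⟨by omega, this.2⟩
      · intro c hc'
        by_cases e : c = i
        · simp [e, hc]
        · simpa [hc, Function.update, e] using h5 c (by omega)
    · intro hb
      have hz : τ.nat 7 (τ.nat 4 i) ≠ 0 := by simpa [hc] using hb
      obtain ⟨f, hf⟩ := Nat.exists_eq_succ_of_ne_zero hz
      obtain ⟨hfi, hcf⟩ := (hhead (τ.nat 4 i)).2 f hf
      have hnf := hcov.next_lt f hfi
      refine (Runs.setNat_seq (T := 5) (by simp [hc, hf]; omega)
        (Runs.setNat_seq (T := 4) (by simp [hc, hf]; omega)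
        (Runs.setNat_seq (T := 3) (by simp [hc, hf]; omega)
        (Runs.setNat_seq (T := 2) (by simp [hc, hf]; omega)
        (Runs.setNat_seq (T := 1) (by simp [hc, hf]; omega)
        (Runs.setNat (by simp [hc, hf]; omega) ?_)))))).mono (by omega) (fun _ h => h)
      refine ⟨by simp [hc], by simp [h4], ?_, ?_, ?_, by simp [h6], by simp [h9]⟩
      · simpa [hc, hf] using hcov.addAfter hfi hcf (by simp [h6])
      · intro c
        have := hhead c
        simp only [Store.setNat_nat, Nat.reduceEqDiff, if_false]
        refine ⟨fun hh u hu => ?_, fun f' hf' => ?_⟩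
        · rcases Nat.lt_succ_iff_lt_or_eq.1 hu with hu | rfl
          · exact this.1 hh u hu
          · rintro rfl
            exact hz hh
        · have := this.2 f' hf'
          exact ⟨by omega, this.2⟩
      · intro c hc'
        by_cases e : c = i
        · simp [e, hc]
        · simpa [hc, Function.update, e] using h5 c (by omega)
  · rintro τ ⟨h4, hcov, hhead, h5, h6, h9⟩
    exact ⟨h4, hcov.congr_comp fun u hu => h5 _ (by rw [h4]; exact hcell u hu), hhead,
      h5, h6, h9⟩

end link

/-! ### The algorithm: merging cycles -/

section merging

variable {d n : ℕ} {I : Input d n} {W : ℕ}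

/-- For every cell of another label than the current one, record one unused neighbour of the
vertex in variable `25`, shifted by one. -/
def witnessProgram : Program :=
  .seq (.forN 23 (.setNat 8 (scalar 23) (.const 0)))
    (.forN 23 (.ite (.and (.edge (scalar 25) (scalar 23))
        (.and (.natEq (.get 6 (scalar 23)) (.const 0))
          (.natNe (.get 5 (.get 4 (scalar 23))) (scalar 31))))
      (.setNat 8 (.get 4 (scalar 23)) (.add (scalar 23) (.const 1))) .skip))

/-- The array `wit` records for every cell of another label than `k` an unused neighbour of `b`,
shifted by one, if there is one. -/
def IsWitness (n : ℕ) (E : ℕ → ℕ → Prop) (cell used comp wit : ℕ → ℕ) (b k : ℕ) : Prop :=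
  ∀ c < n, (wit c = 0 → ∀ v < n, E b v → used v = 0 → comp (cell v) ≠ k → cell v ≠ c) ∧
    ∀ x, wit c = x + 1 → x < n ∧ E b x ∧ used x = 0 ∧ cell x = c ∧ comp c ≠ k

/-- Recording one possible `x` per cell allows a single further scan to find `y`, which makes a
merge attempt linear in `n`. One record suffices: it excludes only itself and its successor as `y`.
-/
theorem runs_witness {σ : Store} (hW : n ≤ W) :
    Runs I W witnessProgram σ (n * 7 + 4) (fun τ =>
      (∀ b, b ≠ 8 → b ≠ 23 → τ.nat b = σ.nat b) ∧
      IsWitness n I.EdgeN (σ.nat 4) (σ.nat 6) (σ.nat 5) (τ.nat 8) (σ.nat 25 0) (σ.nat 31 0)) := by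
  refine (Runs.seq (S := n * 3 + 2) (T := n * 4 + 2) (R := fun τ =>
    (∀ b, b ≠ 8 → b ≠ 23 → τ.nat b = σ.nat b) ∧ ∀ c < n, τ.nat 8 c = 0) ?_ ?_).mono
      (by omega) (fun _ h => h)
  · refine (Runs.forN (c := 23) (T := 1) (fun i τ =>
      (∀ b, b ≠ 8 → b ≠ 23 → τ.nat b = σ.nat b) ∧ ∀ c < i, τ.nat 8 c = 0) hW ?_ ?_ ?_).mono
        le_rfl (fun _ h => h)
    · rintro i τ v ⟨h1, h2⟩
      exact ⟨fun b b1 b2 => by simp [b2, h1 b b1 b2], by simpa using h2⟩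
    · exact ⟨fun _ _ _ => rfl, by simp⟩
    · rintro i τ hi hc ⟨h1, h2⟩
      refine Runs.setNat (by simp) ⟨by simp [hc], fun b b1 b2 => by simp [b1, h1 b b1 b2], ?_⟩
      intro c hc'
      by_cases e : c = i
      · simp [e, hc]
      · simpa [hc, Function.update, e] using h2 c (by omega)
  · rintro τ₀ ⟨g1, g2⟩
    refine (Runs.forN (c := 23) (T := 2) (fun i τ =>
      (∀ b, b ≠ 8 → b ≠ 23 → τ.nat b = σ.nat b) ∧ ∀ c < n,
      (τ.nat 8 c = 0 → ∀ v < i, I.EdgeN (σ.nat 25 0) v → σ.nat 6 v = 0 →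
        σ.nat 5 (σ.nat 4 v) ≠ σ.nat 31 0 → σ.nat 4 v ≠ c) ∧
      ∀ x, τ.nat 8 c = x + 1 → x < n ∧ I.EdgeN (σ.nat 25 0) x ∧ σ.nat 6 x = 0 ∧ σ.nat 4 x = c ∧
        σ.nat 5 c ≠ σ.nat 31 0) hW ?_ ?_ ?_).mono le_rfl (fun _ h => h)
    · rintro i τ v ⟨h1, h2⟩
      exact ⟨fun b b1 b2 => by simp [b2, h1 b b1 b2], by simpa using h2⟩
    · exact ⟨g1, fun c hc => ⟨by simp, by simp [g2 c hc]⟩⟩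
    · rintro i τ hi hc ⟨h1, h2⟩
      have h4 := h1 4 (by simp) (by simp)
      have h5 := h1 5 (by simp) (by simp)
      have h6 := h1 6 (by simp) (by simp)
      have h25 := h1 25 (by simp) (by simp)
      have h31 := h1 31 (by simp) (by simp)
      refine Runs.ite (fun hb => ?_) (fun hb => ?_)
      · simp only [Test.holds_and, Test.holds_edge, Test.holds_natEq, Test.holds_natNe,
          NatExpr.eval_get, NatExpr.eval_const, hc, h4, h5, h6, h25, h31] at hb
        obtain ⟨b1, b2, b3⟩ := hb
        refine Runs.setNat (by simp [hc]; omega)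
          ⟨by simp [hc], fun b b1 b2 => by simp [b1, h1 b b1 b2], ?_⟩
        intro c hc'
        by_cases e : c = σ.nat 4 i
        · subst e
          refine ⟨by simp [hc, h4], fun x hx => ?_⟩
          obtain rfl : x = i := by
            have : i + 1 = x + 1 := by simpa [hc, h4] using hx
            omega
          exact ⟨hi, b1, b2, rfl, b3⟩
        · simp only [NatExpr.eval_get, NatExpr.eval_const, hc, h4, Store.setNat_nat, if_true,
            ne_eq, e, not_false_eq_true, Function.update_of_ne]
          refine ⟨fun hz v hv q1 q2 q3 => ?_, (h2 c hc').2⟩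
          rcases Nat.lt_succ_iff_lt_or_eq.1 hv with hv | rfl
          · exact (h2 c hc').1 hz v hv q1 q2 q3
          · exact fun e' => e e'.symm
      · simp only [Test.holds_and, Test.holds_edge, Test.holds_natEq, Test.holds_natNe,
          NatExpr.eval_get, NatExpr.eval_const, hc, h4, h5, h6, h25, h31] at hb
        refine Runs.skip ⟨hc, h1, fun c hc' => ⟨fun hz v hv q1 q2 q3 => ?_, (h2 c hc').2⟩⟩
        rcases Nat.lt_succ_iff_lt_or_eq.1 hv with hv | rfl
        · exact (h2 c hc').1 hz v hv q1 q2 q3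
        · exact absurd ⟨q1, q2, q3⟩ hb

/-- Record in variable `24` an unused neighbour, shifted by one, of the vertex in variable `30`
whose cell has another recorded vertex, which is not its predecessor. -/
def candidateProgram : Program :=
  .seq (.setNat 24 (.const 0) (.const 0))
    (.forN 23 (.ite (.and (.edge (scalar 30) (scalar 23))
        (.and (.natEq (.get 6 (scalar 23)) (.const 0))
        (.and (.natNe (.get 8 (.get 4 (scalar 23))) (.const 0))
        (.and (.natNe (.add (scalar 23) (.const 1)) (.get 8 (.get 4 (scalar 23))))
          (.natNe (.add (.get 3 (scalar 23)) (.const 1)) (.get 8 (.get 4 (scalar 23))))))))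
      (.setNat 24 (.const 0) (.add (scalar 23) (.const 1))) .skip))

/-- The condition tested by `candidateProgram`. -/
def IsCandidate (E : ℕ → ℕ → Prop) (cell prev used wit : ℕ → ℕ) (a v : ℕ) : Prop :=
  E a v ∧ used v = 0 ∧ wit (cell v) ≠ 0 ∧ v + 1 ≠ wit (cell v) ∧ prev v + 1 ≠ wit (cell v)

theorem runs_candidate {σ : Store} (hW : n ≤ W) :
    Runs I W candidateProgram σ (n * 4 + 3) (fun τ =>
      (∀ b, b ≠ 24 → b ≠ 23 → τ.nat b = σ.nat b) ∧
      (τ.nat 24 0 = 0 → ∀ v < n,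
        ¬ IsCandidate I.EdgeN (σ.nat 4) (σ.nat 3) (σ.nat 6) (σ.nat 8) (σ.nat 30 0) v) ∧
      ∀ y, τ.nat 24 0 = y + 1 → y < n ∧
        IsCandidate I.EdgeN (σ.nat 4) (σ.nat 3) (σ.nat 6) (σ.nat 8) (σ.nat 30 0) y) := by
  refine (Runs.setNat_seq (T := n * 4 + 2) (by simp)
    (Runs.forN (c := 23) (T := 2) (fun i τ =>
      (∀ b, b ≠ 24 → b ≠ 23 → τ.nat b = σ.nat b) ∧
      (τ.nat 24 0 = 0 → ∀ v < i,
        ¬ IsCandidate I.EdgeN (σ.nat 4) (σ.nat 3) (σ.nat 6) (σ.nat 8) (σ.nat 30 0) v) ∧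
      ∀ y, τ.nat 24 0 = y + 1 → y < n ∧
        IsCandidate I.EdgeN (σ.nat 4) (σ.nat 3) (σ.nat 6) (σ.nat 8) (σ.nat 30 0) y)
      hW ?_ ?_ ?_)).mono (by omega) (fun _ h => h)
  · rintro i τ v ⟨h1, h2⟩
    exact ⟨fun b b1 b2 => by simp [b2, h1 b b1 b2], by simpa using h2⟩
  · exact ⟨fun b b1 b2 => by simp [b1], by simp, by simp⟩
  · rintro i τ hi hc ⟨h1, h2, h3⟩
    have e3 := h1 3 (by simp) (by simp)
    have e4 := h1 4 (by simp) (by simp)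
    have e6 := h1 6 (by simp) (by simp)
    have e8 := h1 8 (by simp) (by simp)
    have e30 := h1 30 (by simp) (by simp)
    refine Runs.ite (fun hb => ?_) (fun hb => ?_) <;>
      simp only [Test.holds_and, Test.holds_edge, Test.holds_natEq, Test.holds_natNe,
        NatExpr.eval_get, NatExpr.eval_const, NatExpr.eval_add, hc, e3, e4, e6, e8, e30] at hb
    · refine Runs.setNat (by simp [hc]; omega)
        ⟨by simp [hc], fun b b1 b2 => by simp [b1, h1 b b1 b2], by simp [hc], fun y hy => ?_⟩
      obtain rfl : y = i := by
        have : i + 1 = y + 1 := by simpa [hc] using hy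
        omega
      exact ⟨hi, hb⟩
    · refine Runs.skip ⟨hc, h1, fun hz v hv => ?_, h3⟩
      rcases Nat.lt_succ_iff_lt_or_eq.1 hv with hv | rfl
      · exact h2 hz v hv
      · exact hb

/-- Load the vertices and the label that a merge needs. -/
def loadProgram : Program :=
  .seq (.setNat 32 (.const 0) (.sub (scalar 24) (.const 1)))
  (.seq (.setNat 26 (.const 0) (.sub (.get 8 (.get 4 (scalar 32))) (.const 1)))
  (.seq (.setNat 27 (.const 0) (.get 2 (scalar 26)))
  (.seq (.setNat 28 (.const 0) (.get 3 (scalar 32)))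
  (.seq (.setNat 29 (.const 0) (.get 2 (scalar 32)))
    (.setNat 33 (.const 0) (.get 5 (.get 4 (scalar 26))))))))

/-- Four assignments to the array `b`, at the indices and with the values of given variables. -/
def updateProgram (b : ℕ) (i₁ i₂ i₃ i₄ : ℕ) (e₁ e₂ e₃ e₄ : NatExpr) : Program :=
  .seq (.setNat b (scalar i₁) e₁) (.seq (.setNat b (scalar i₂) e₂)
    (.seq (.setNat b (scalar i₃) e₃) (.setNat b (scalar i₄) e₄)))

/-- Give all cells with the label in variable `31` the label in variable `33`. -/
def relabelProgram : Program :=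
  .forN 23 (.ite (.natEq (.get 5 (scalar 23)) (scalar 31))
    (.setNat 5 (scalar 23) (scalar 33)) .skip)

/-- Merge the cycle of the vertex in variable `30` with the cycle of the recorded candidate. -/
def mergeProgram : Program :=
  .seq loadProgram
  (.seq (updateProgram 2 26 30 32 28 (scalar 25) (scalar 32) (scalar 27) (scalar 29))
  (.seq (updateProgram 3 25 32 27 29 (scalar 26) (scalar 30) (scalar 32) (scalar 28))
  (.seq (updateProgram 6 30 25 26 32 (.const 1) (.const 1) (.const 1) (.const 1))
    relabelProgram)))

/-- The second half of `he` says that the expressions do not read the array `b`, so all four take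
their values in the initial memory. -/
theorem runs_updateProgram {σ : Store} {b i₁ i₂ i₃ i₄ : ℕ} {e₁ e₂ e₃ e₄ : NatExpr}
    (hi : i₁ ≠ b ∧ i₂ ≠ b ∧ i₃ ≠ b ∧ i₄ ≠ b)
    (he : ∀ e ∈ [e₁, e₂, e₃, e₄], e.eval I σ ≤ W ∧
      ∀ τ : Store, (∀ c, c ≠ b → τ.nat c = σ.nat c) → e.eval I τ = e.eval I σ) :
    Runs I W (updateProgram b i₁ i₂ i₃ i₄ e₁ e₂ e₃ e₄) σ 4 (fun τ =>
      τ.nat b = Function.update (Function.update (Function.update (Function.update (σ.nat b)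
        (σ.nat i₁ 0) (e₁.eval I σ)) (σ.nat i₂ 0) (e₂.eval I σ)) (σ.nat i₃ 0) (e₃.eval I σ))
        (σ.nat i₄ 0) (e₄.eval I σ) ∧
      ∀ c, c ≠ b → τ.nat c = σ.nat c) := by
  obtain ⟨g1, g2, g3, g4⟩ := hi
  simp only [List.mem_cons, List.not_mem_nil, or_false, forall_eq_or_imp, forall_eq] at he
  obtain ⟨⟨w1, -⟩, ⟨w2, f2⟩, ⟨w3, f3⟩, ⟨w4, f4⟩⟩ := he
  refine Runs.setNat_seq (T := 3) w1 ?_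
  have q2 := f2 (σ.setNat b ((scalar i₁).eval I σ) (e₁.eval I σ)) (fun c hc => by simp [hc])
  refine Runs.setNat_seq (T := 2) (by rwa [q2]) ?_
  rw [q2]
  refine Runs.setNat_seq (T := 1) ?_ ?_
  · rwa [f3 _ (fun c hc => by simp [hc])]
  rw [f3 _ (fun c hc => by simp [hc])]
  refine Runs.setNat ?_ ?_
  · rwa [f4 _ (fun c hc => by simp [hc])]
  rw [f4 _ (fun c hc => by simp [hc])]
  exact ⟨by simp [g2, g3, g4], fun c hc => by simp [hc]⟩

theorem runs_relabel {σ : Store} (hW : n ≤ W) (hl : σ.nat 33 0 ≤ W) :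
    Runs I W relabelProgram σ (n * 4 + 2) (fun τ =>
      (∀ b, b ≠ 5 → b ≠ 23 → τ.nat b = σ.nat b) ∧
      τ.nat 5 = mergeComp n (σ.nat 5) (σ.nat 31 0) (σ.nat 33 0)) := by
  refine Runs.forN (c := 23) (T := 2) (fun i τ =>
      (∀ b, b ≠ 5 → b ≠ 23 → τ.nat b = σ.nat b) ∧
      τ.nat 5 = mergeComp i (σ.nat 5) (σ.nat 31 0) (σ.nat 33 0)) hW ?_ ?_ ?_
  · rintro i τ v ⟨h1, h2⟩
    exact ⟨fun b b1 b2 => by simp [b2, h1 b b1 b2], by simpa using h2⟩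
  · exact ⟨fun _ _ _ => rfl, by funext c; simp [mergeComp]⟩
  · rintro i τ hi hc ⟨h1, h2⟩
    have e31 := h1 31 (by simp) (by simp)
    have e33 := h1 33 (by simp) (by simp)
    have val : τ.nat 5 i = σ.nat 5 i := by simp [h2, mergeComp]
    refine Runs.ite (fun hb => ?_) (fun hb => ?_) <;>
      simp only [Test.holds_natEq, NatExpr.eval_get, NatExpr.eval_const, hc, e31, val] at hb
    · refine Runs.setNat (by simpa [e33] using hl)
        ⟨by simp [hc], fun b b1 b2 => by simp [b1, h1 b b1 b2], ?_⟩
      funext c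
      by_cases e : c = i
      · simp [e, hc, mergeComp, hb, e33]
      · have : c < i + 1 ↔ c < i := by omega
        simp [hc, Function.update, e, h2, mergeComp, this]
    · refine Runs.skip ⟨hc, h1, ?_⟩
      rw [h2]
      funext c
      by_cases e : c = i
      · simp [e, mergeComp, hb]
      · have : c < i + 1 ↔ c < i := by omega
        simp [mergeComp, this]

/-- The merging part of the program does what `CycleCover.merge` describes. -/
theorem runs_merge {σ : Store} {cell next prev used comp : ℕ → ℕ} {a x y : ℕ} (hW : n ≤ W)
    (hcomp : ∀ u < n, comp (cell u) ≤ W)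
    (hcov : CycleCover n I.EdgeN cell next prev used comp)
    (m : Mergeable n I.EdgeN cell next prev used comp a x y)
    (h2 : σ.nat 2 = next) (h3 : σ.nat 3 = prev) (h4 : σ.nat 4 = cell) (h5 : σ.nat 5 = comp)
    (h6 : σ.nat 6 = used) (h30 : σ.nat 30 0 = a) (h25 : σ.nat 25 0 = next a)
    (h31 : σ.nat 31 0 = comp (cell a)) (h24 : σ.nat 24 0 = y + 1)
    (h8 : σ.nat 8 (cell y) = x + 1) :
    Runs I W mergeProgram σ (n * 4 + 20) (fun τ =>
      τ.nat 2 = mergeNext next prev a x y ∧ τ.nat 3 = mergePrev next prev a x y ∧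
      τ.nat 4 = cell ∧ τ.nat 6 = mergeUsed used next a x y ∧
      τ.nat 5 = mergeComp n comp (comp (cell a)) (comp (cell x)) ∧
      ∀ b, b = 7 ∨ b = 9 ∨ b = 22 → τ.nat b = σ.nat b) := by
  have la := m.lt_a
  have lx := m.lt_x
  have ly := m.lt_y
  have lna := hcov.next_lt a la
  have lnx := hcov.next_lt x lx
  have lny := hcov.next_lt y ly
  have lpy := hcov.prev_lt y ly
  have lc := hcomp x lx
  -- All old pointers are saved before an array is overwritten, since `mergeNext` and `mergePrev`
  -- refer to the old functions throughout.
  have hload : Runs I W loadProgram σ 6 (fun τ => τ.nat 32 0 = y ∧ τ.nat 26 0 = x ∧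
      τ.nat 27 0 = next x ∧ τ.nat 28 0 = prev y ∧ τ.nat 29 0 = next y ∧ τ.nat 33 0 = comp (cell x) ∧
      ∀ b, b < 26 ∨ b = 30 ∨ b = 31 → τ.nat b = σ.nat b) := by
    refine Runs.setNat_seq (T := 5) (by simp [h24]; omega) ?_
    refine Runs.setNat_seq (T := 4) (by simp [h24, h4, h8]; omega) ?_
    refine Runs.setNat_seq (T := 3) (by simp [h24, h4, h8, h2]; omega) ?_
    refine Runs.setNat_seq (T := 2) (by simp [h24, h3]; omega) ?_
    refine Runs.setNat_seq (T := 1) (by simp [h24, h2]; omega) ?_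
    refine Runs.setNat (by simpa [h24, h4, h8, h5] using lc) ?_
    refine ⟨by simp [h24], by simp [h24, h4, h8], by simp [h24, h4, h8, h2], by simp [h24, h3],
      by simp [h24, h2], by simp [h24, h4, h8, h5], fun b hb => ?_⟩
    simp [show b ≠ 32 by omega, show b ≠ 26 by omega, show b ≠ 27 by omega,
      show b ≠ 28 by omega, show b ≠ 29 by omega, show b ≠ 33 by omega]
  refine (Runs.seq hload (T := 4 + (4 + (4 + (n * 4 + 2)))) ?_).mono (by omega) (fun _ h => h)
  rintro τ ⟨t32, t26, t27, t28, t29, t33, tb⟩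
  have t25 : τ.nat 25 0 = next a := by rw [tb 25 (by simp), h25]
  have t30 : τ.nat 30 0 = a := by rw [tb 30 (by simp), h30]
  refine Runs.seq (runs_updateProgram (by simp) ?_) ?_
  · simp only [List.mem_cons, List.not_mem_nil, or_false, forall_eq_or_imp, forall_eq,
      NatExpr.eval_get, NatExpr.eval_const, t25, t32, t27, t29]
    refine ⟨⟨by omega, ?_⟩, ⟨by omega, ?_⟩, ⟨by omega, ?_⟩, ⟨by omega, ?_⟩⟩ <;>
      intro υ hυ <;> simp [hυ, t25, t32, t27, t29]
  rintro υ ⟨u2, ub⟩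
  have v25 : υ.nat 25 0 = next a := by rw [ub 25 (by simp), t25]
  have v26 : υ.nat 26 0 = x := by rw [ub 26 (by simp), t26]
  have v27 : υ.nat 27 0 = next x := by rw [ub 27 (by simp), t27]
  have v28 : υ.nat 28 0 = prev y := by rw [ub 28 (by simp), t28]
  have v29 : υ.nat 29 0 = next y := by rw [ub 29 (by simp), t29]
  have v30 : υ.nat 30 0 = a := by rw [ub 30 (by simp), t30]
  have v32 : υ.nat 32 0 = y := by rw [ub 32 (by simp), t32]
  refine Runs.seq (runs_updateProgram (by simp) ?_) ?_
  · simp only [List.mem_cons, List.not_mem_nil, or_false, forall_eq_or_imp, forall_eq,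
      NatExpr.eval_get, NatExpr.eval_const, v26, v30, v32, v28]
    refine ⟨⟨by omega, ?_⟩, ⟨by omega, ?_⟩, ⟨by omega, ?_⟩, ⟨by omega, ?_⟩⟩ <;>
      intro ω hω <;> simp [hω, v26, v30, v32, v28]
  rintro ω ⟨w3, wb⟩
  refine Runs.seq (runs_updateProgram (by simp) (by simp; omega)) ?_
  rintro θ ⟨x6, xb⟩
  have low : ∀ b, b < 26 ∨ b = 30 ∨ b = 31 → b ≠ 2 → b ≠ 3 → b ≠ 6 → θ.nat b = σ.nat b := by
    intro b hb b2 b3 b6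
    rw [xb b b6, wb b b3, ub b b2, tb b hb]
  have x33 : θ.nat 33 0 = comp (cell x) := by
    rw [xb 33 (by simp), wb 33 (by simp), ub 33 (by simp), t33]
  refine (runs_relabel hW (by rwa [x33])).mono le_rfl ?_
  rintro ξ ⟨y1, y5⟩
  refine ⟨?_, ?_, ?_, ?_, ?_, fun b hb => ?_⟩
  · rw [y1 2 (by simp) (by simp), xb 2 (by simp), wb 2 (by simp), u2]
    simp [t25, t26, t27, t28, t29, t30, t32, tb 2 (by omega), h2, mergeNext]
  · rw [y1 3 (by simp) (by simp), xb 3 (by simp), w3]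
    simp [v25, v26, v27, v28, v29, v30, v32, ub 3 (by simp), tb 3 (by omega), h3, mergePrev]
  · rw [y1 4 (by simp) (by simp), low 4 (by simp) (by simp) (by simp) (by simp), h4]
  · rw [y1 6 (by simp) (by simp), x6]
    simp [wb, v25, v26, v30, v32, ub 6 (by simp), tb 6 (by simp), h6, mergeUsed]
  · rw [y5, x33, low 5 (by simp) (by simp) (by simp) (by simp),
      low 31 (by simp) (by simp) (by simp) (by simp), h31, h5]
  · rw [y1 b (by omega) (by omega), low b (by omega) (by omega) (by omega) (by omega)]

/-- Try to merge the cycle of the cell in variable `22` with another cycle. -/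
def processProgram : Program :=
  .ite (.natEq (.get 7 (scalar 22)) (.const 0)) .skip
  (.seq (.setNat 30 (.const 0) (.sub (.get 7 (scalar 22)) (.const 1)))
  (.seq (.setNat 25 (.const 0) (.get 2 (scalar 30)))
  (.seq (.setNat 31 (.const 0) (.get 5 (scalar 22)))
  (.seq witnessProgram
  (.seq candidateProgram
    (.ite (.natEq (scalar 24) (.const 0)) .skip mergeProgram))))))

/-- The invariant of the merging loop when the cells below `c` have been processed. -/
structure MergeInv (I : Input d n) (cell head : ℕ → ℕ) (c : ℕ) (σ : Store) : Prop where
  nat_cell : σ.nat 4 = cell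
  nat_head : σ.nat 7 = head
  nat_visited : σ.nat 9 = fun _ => 0
  comp_lt : ∀ u < n, σ.nat 5 (cell u) < n
  cover : CycleCover n I.EdgeN cell (σ.nat 2) (σ.nat 3) (σ.nat 6) (σ.nat 5)
  -- Only progress depends on the neighbours being well spread; the cover is maintained on every
  -- input.
  progress : ∀ N, WellSpread n N I.EdgeN cell → Progress n N cell (σ.nat 6) (σ.nat 5) c

/-- A successful search yields a `Mergeable` triple. An unsuccessful one is exactly the hypothesis
of `WellSpread.majorLabel` with `b = next a`, so the cell may be skipped. -/
theorem runs_process {cell head : ℕ → ℕ} {c : ℕ} {σ : Store} (hW : n ≤ W)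
    (hcell : ∀ u < n, cell u < n) (hhead : IsHead n cell head)
    (h22 : σ.nat 22 0 = c) (h : MergeInv I cell head c σ) :
    Runs I W processProgram σ (n * 15 + 32) (fun τ => τ.nat 22 0 = c ∧
      MergeInv I cell head (c + 1) τ) := by
  obtain ⟨h4, h7, h9, hlt, hcov, hprog⟩ := h
  refine (Runs.ite (T := n * 15 + 31) (fun hb => ?_) (fun hb => ?_)).mono (by omega)
    (fun _ h => h) <;>
    simp only [Test.holds_natEq, NatExpr.eval_get, NatExpr.eval_const, h22, h7] at hb
  · refine (Runs.skip ⟨h22, h4, h7, h9, hlt, hcov, fun N hs => (hprog N hs).skip ?_⟩).mono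
      (by omega) (fun _ h => h)
    intro u hu e
    exact absurd e ((hhead c).1 hb u hu)
  obtain ⟨a, ha⟩ := Nat.exists_eq_succ_of_ne_zero hb
  obtain ⟨lta, hca⟩ := (hhead c).2 a ha
  have lna := hcov.next_lt a lta
  have lca := hlt a lta
  rw [hca] at lca
  rw [show n * 15 + 31 = 1 + (1 + (1 + (n * 15 + 28))) by omega]
  refine Runs.setNat_seq (by simp [h22, h7, ha]; omega) ?_
  refine Runs.setNat_seq (by simp [h22, h7, ha]; omega) ?_
  refine Runs.setNat_seq (by simp [h22]; omega) ?_
  set σ' := ((σ.setNat 30 _ _).setNat 25 _ _).setNat 31 _ _ with hσ'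
  have g30 : σ'.nat 30 0 = a := by simp [hσ', h22, h7, ha]
  have g25 : σ'.nat 25 0 = σ.nat 2 a := by simp [hσ', h22, h7, ha]
  have g31 : σ'.nat 31 0 = σ.nat 5 c := by simp [hσ', h22]
  have gb : ∀ b, b ≠ 30 → b ≠ 25 → b ≠ 31 → σ'.nat b = σ.nat b := by
    intro b b1 b2 b3
    simp [hσ', b1, b2, b3]
  clear_value σ'
  refine (Runs.seq (runs_witness hW) (T := n * 8 + 24) ?_).mono (by omega) (fun _ h => h)
  rintro τ ⟨tb, hwit⟩
  refine (Runs.seq (runs_candidate hW) (T := n * 4 + 21) ?_).mono (by omega) (fun _ h => h)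
  rintro υ ⟨ub, hz, hcand⟩
  have fr : ∀ b, b < 8 ∨ b = 9 ∨ b = 22 → υ.nat b = σ.nat b := by
    intro b hb
    rw [ub b (by omega) (by omega), tb b (by omega) (by omega),
      gb b (by omega) (by omega) (by omega)]
  rw [g25, g31, gb 4 (by simp) (by simp) (by simp), gb 5 (by simp) (by simp) (by simp),
    gb 6 (by simp) (by simp) (by simp), h4] at hwit
  rw [tb 4 (by simp) (by simp), tb 3 (by simp) (by simp), tb 6 (by simp) (by simp),
    tb 30 (by simp) (by simp), g30, gb 4 (by simp) (by simp) (by simp),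
    gb 3 (by simp) (by simp) (by simp), gb 6 (by simp) (by simp) (by simp), h4] at hz hcand
  refine Runs.ite (T := n * 4 + 20) (fun hb => ?_) (fun hb => ?_) <;>
    simp only [Test.holds_natEq, NatExpr.eval_get, NatExpr.eval_const] at hb
  · refine (Runs.skip ?_).mono (by omega) (fun _ h => h)
    refine ⟨by rw [fr 22 (by simp), h22], by rw [fr 4 (by simp), h4], by rw [fr 7 (by simp), h7],
      by rw [fr 9 (by simp), h9], by rwa [fr 5 (by simp)], ?_, ?_⟩
    · rwa [fr 2 (by simp), fr 3 (by simp), fr 5 (by simp), fr 6 (by simp)]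
    · intro N hs
      rw [fr 5 (by simp), fr 6 (by simp)]
      refine (hprog N hs).skip fun u hu hcu => ?_
      rw [← hca]
      refine hs.majorLabel (((hprog N hs).used_le).trans (by omega)) lta lna ?_
      intro q hq hqa
      by_cases hqn : q < n
      · rcases Nat.eq_zero_or_pos (τ.nat 8 q) with e | e
        · left
          intro v hv q1 q2 q3
          exact (hwit q hqn).1 e v hv q1 q2 (by rw [q3, ← hca]; exact hqa) q3
        · obtain ⟨x, hx⟩ := Nat.exists_eq_succ_of_ne_zero e.ne'
          -- An unused neighbour of `a` in this cell that is not a candidate equals the recorded `x`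
          -- or has it as predecessor.
          refine .inr ⟨x, σ.nat 2 x, fun v hv q1 q2 q3 => ?_⟩
          have := hz hb v hv
          rw [IsCandidate, q3, hx] at this
          by_contra hcon
          rw [not_or] at hcon
          refine this ⟨q1, q2, by omega, by omega, fun e' => hcon.2 ?_⟩
          have e'' : σ.nat 3 v = x := by omega
          rw [← e'', hcov.next_prev v hv]
      · exact .inl fun v hv _ _ e => hqn (e ▸ hcell v hv)
  · obtain ⟨y, hy⟩ := Nat.exists_eq_succ_of_ne_zero hb
    obtain ⟨lty, c1, c2, c3, c4, c5⟩ := hcand y hy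
    obtain ⟨x, hx⟩ := Nat.exists_eq_succ_of_ne_zero c3
    obtain ⟨ltx, w1, w2, w3, w4⟩ := (hwit _ (hcell y lty)).2 x hx
    have hm : Mergeable n I.EdgeN cell (σ.nat 2) (σ.nat 3) (σ.nat 6) (σ.nat 5) a x y :=
      ⟨lta, ltx, lty, w1, c1, w2, c2, w3, by rwa [hca], by omega, by omega⟩
    refine (runs_merge hW (fun u hu => (hlt u hu).le.trans hW) hcov hm (fr 2 (by simp))
      (fr 3 (by simp)) (by rw [fr 4 (by simp), h4]) (fr 5 (by simp)) (fr 6 (by simp))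
      (by rw [ub 30 (by simp) (by simp), tb 30 (by simp) (by simp), g30])
      (by rw [ub 25 (by simp) (by simp), tb 25 (by simp) (by simp), g25])
      (by rw [ub 31 (by simp) (by simp), tb 31 (by simp) (by simp), g31, hca]) hy
      (by rw [ub 8 (by simp) (by simp), hx])).mono le_rfl ?_
    rintro ω ⟨v2, v3, v4, v6, v5, vb⟩
    refine ⟨by rw [vb 22 (by simp), fr 22 (by simp), h22], v4,
      by rw [vb 7 (by simp), fr 7 (by simp), h7], by rw [vb 9 (by simp), fr 9 (by simp), h9],
      fun u hu => ?_, ?_, fun N hs => ?_⟩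
    · rw [v5, mergeComp]
      have := hlt u hu
      have := hlt x ltx
      split_ifs <;> assumption
    · rw [v2, v3, v5, v6]
      exact hcov.merge (fun _ _ e => e.symm) hcell hm
    · rw [v5, v6]
      exact (hprog N hs).merge hcell hs.cell_lt hca hm

theorem runs_processAll {cell head : ℕ → ℕ} {σ : Store} (hW : n ≤ W)
    (hcell : ∀ u < n, cell u < n) (hhead : IsHead n cell head) (h : MergeInv I cell head 0 σ) :
    Runs I W (.forN 22 processProgram) σ (n * (n * 15 + 34) + 2) (MergeInv I cell head n) := by
  refine Runs.forN (c := 22) (T := n * 15 + 32) (MergeInv I cell head) hW ?_ h ?_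
  · rintro i τ v ⟨h1, h2, h3, h4, h5, h6⟩
    exact ⟨by simpa using h1, by simpa using h2, by simpa using h3, by simpa using h4,
      by simpa using h5, by simpa using h6⟩
  · exact fun i τ _ hc hI => runs_process hW hcell hhead hc hI

end merging

/-! ### The algorithm: output and verification -/

section output

variable {d n : ℕ} {I : Input d n} {W : ℕ}

/-- The squared distance of two of the input points in the first coordinates. -/
def sqDistExpr (e f : NatExpr) : ℕ → RealExpr
  | 0 => .ofNat (.const 0)
  | k + 1 => .add (sqDistExpr e f k) (.mul (.sub (.coord e (.const k)) (.coord f (.const k)))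
      (.sub (.coord e (.const k)) (.coord f (.const k))))

theorem eval_sqDistExpr (σ : Store) (e f : NatExpr) (K : ℕ) :
    (sqDistExpr e f K).eval I σ =
      ∑ k ∈ Finset.range K, (I.coordN (e.eval I σ) k - I.coordN (f.eval I σ) k) ^ 2 := by
  induction K with
  | zero => simp [sqDistExpr, RealExpr.eval]
  | succ K ih =>
    rw [Finset.sum_range_succ, ← ih, sq]
    rfl

/-- The points of two vertices are within the radius of each other. -/
def Input.NearN (I : Input d n) (u v : ℕ) : Prop :=
  ∑ k ∈ Finset.range d, (I.coordN u k - I.coordN v k) ^ 2 ≤ I.radius * I.radius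

/-- The test that two vertices are neither adjacent nor near. -/
def nonAdjTest (d : ℕ) (e f : NatExpr) : Test :=
  .and (.not (.edge e f)) (.not (.realLe (sqDistExpr e f d) (.mul .radius .radius)))

theorem holds_nonAdjTest (σ : Store) (e f : NatExpr) :
    (nonAdjTest d e f).Holds I σ ↔
      ¬ (I.EdgeN (e.eval I σ) (f.eval I σ) ∨ I.NearN (e.eval I σ) (f.eval I σ)) := by
  have h := eval_sqDistExpr (I := I) σ e f d
  rw [nonAdjTest, Test.holds_and, not_or]
  refine and_congr ?_ ?_
  · change ¬ Test.Holds I σ _ ↔ _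
    rw [Test.holds_edge]
  · change ¬ ((sqDistExpr e f d).eval I σ ≤ I.radius * I.radius) ↔ _
    rw [h, Input.NearN]

/-- Write the walk from the vertex `0` to the output array, and mark its vertices. -/
def walkProgram : Program :=
  .seq (.setNat 33 (.const 0) (.const 0))
  (.seq (.forN 22 (.seq (.setNat 1 (scalar 22) (scalar 33))
    (.seq (.setNat 9 (scalar 33) (.const 1))
      (.setNat 33 (.const 0) (.get 2 (scalar 33))))))
    -- The extra entry at index `n` closes the walk, so that the check can compare the entries `i`
    -- and `i + 1` for all `i < n`.
    (.setNat 1 .size (.const 0)))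

theorem runs_walk {σ : Store} (hn : 1 ≤ n) (hW : n ≤ W) (hnext : ∀ u < n, σ.nat 2 u < n)
    (h9 : σ.nat 9 = fun _ => 0) :
    Runs I W walkProgram σ (n * 5 + 4) (fun τ =>
      (∀ i < n, τ.nat 1 i = (σ.nat 2)^[i] 0) ∧ τ.nat 1 n = 0 ∧
      ∀ u, τ.nat 9 u = 0 ↔ ¬ ∃ i < n, (σ.nat 2)^[i] 0 = u) := by
  have hlt : ∀ i, (σ.nat 2)^[i] 0 < n := by
    intro i
    induction i with
    | zero => exact hn
    | succ i ih => rw [Function.iterate_succ_apply']; exact hnext _ ih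
  refine (Runs.setNat_seq (T := n * 5 + 2 + 1) (by simp) ?_).mono (by omega) (fun _ h => h)
  refine Runs.seq (Runs.forN (c := 22) (T := 3) (fun i τ => τ.nat 2 = σ.nat 2 ∧
      τ.nat 33 0 = (σ.nat 2)^[i] 0 ∧ (∀ j < i, τ.nat 1 j = (σ.nat 2)^[j] 0) ∧
      ∀ u, τ.nat 9 u = 0 ↔ ¬ ∃ j < i, (σ.nat 2)^[j] 0 = u) hW ?_ ?_ ?_) ?_
  · rintro i τ v h
    simpa using h
  · simp [h9]
  · rintro i τ hi hc ⟨h2, h33, h1, hv⟩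
    have hl := hlt i
    have hl' := hlt (i + 1)
    rw [Function.iterate_succ_apply'] at hl'
    rw [show 3 = 1 + (1 + 1) by rfl]
    refine Runs.setNat_seq (by simp [h33]; omega) ?_
    refine Runs.setNat_seq (by simp; omega) ?_
    refine Runs.setNat (by simp [h33, h2]; omega) ⟨by simp [hc], by simp [h2], ?_, ?_, ?_⟩
    · simp [h33, h2, Function.iterate_succ_apply']
    · intro j hj
      by_cases e : j = i
      · simp [e, hc, h33]
      · simpa [hc, Function.update, e] using h1 j (by omega)
    · intro u
      by_cases e : u = (σ.nat 2)^[i] 0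
      · subst e
        simp only [Store.setNat_nat]
        simp [h33]
        exact ⟨i, by omega, rfl⟩
      · have e1 : (∃ j < i + 1, (σ.nat 2)^[j] 0 = u) ↔ ∃ j < i, (σ.nat 2)^[j] 0 = u := by
          constructor
          · rintro ⟨j, hj, rfl⟩
            exact ⟨j, lt_of_le_of_ne (by omega) (by rintro rfl; exact e rfl), rfl⟩
          · rintro ⟨j, hj, hu⟩
            exact ⟨j, by omega, hu⟩
        rw [e1, ← hv u]
        simp [h33, Function.update, e]
  · rintro τ ⟨h2, h33, h1, hv⟩
    refine Runs.setNat (by simp) ⟨fun i hi => ?_, by simp, fun u => by simpa using hv u⟩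
    simpa [Function.update, hi.ne] using h1 i hi

/-- Set the variable `34` to `0` if the test holds for some value of the variable `22`. -/
def rejectProgram (b : Test) : Program :=
  .forN 22 (.ite b (.setNat 34 (.const 0) (.const 0)) .skip)

theorem runs_reject {b : Test} {P : ℕ → Prop} {σ : Store} (hW : n ≤ W)
    (hb : ∀ i < n, ∀ τ : Store, τ.nat 22 0 = i → (∀ c, c ≠ 22 → c ≠ 34 → τ.nat c = σ.nat c) →
      (b.Holds I τ ↔ P i)) :
    Runs I W (rejectProgram b) σ (n * 4 + 2) (fun τ =>
      (τ.nat 34 0 ≠ 0 ↔ σ.nat 34 0 ≠ 0 ∧ ∀ i < n, ¬ P i) ∧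
      ∀ c, c ≠ 22 → c ≠ 34 → τ.nat c = σ.nat c) := by
  refine Runs.forN (c := 22) (T := 2) (fun i τ =>
      (τ.nat 34 0 ≠ 0 ↔ σ.nat 34 0 ≠ 0 ∧ ∀ j < i, ¬ P j) ∧
      ∀ c, c ≠ 22 → c ≠ 34 → τ.nat c = σ.nat c) hW ?_ ?_ ?_
  · rintro i τ v ⟨h1, h2⟩
    exact ⟨by simpa using h1, fun c c1 c2 => by simp [c1, h2 c c1 c2]⟩
  · exact ⟨by simp, fun _ _ _ => rfl⟩
  · rintro i τ hi hc ⟨h1, h2⟩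
    refine Runs.ite (fun hbt => ?_) (fun hbt => ?_) <;> rw [hb i hi τ hc h2] at hbt
    · refine Runs.setNat (by simp) ⟨by simp [hc], ?_, fun c c1 c2 => by simp [c2, h2 c c1 c2]⟩
      simp only [NatExpr.eval_const, Store.setNat_nat, if_true, Function.update_self, ne_eq,
        not_true_eq_false, false_iff, not_and]
      exact fun _ hall => hall i (by omega) hbt
    · refine Runs.skip ⟨hc, ?_, h2⟩
      rw [h1]
      refine and_congr_right fun _ => ⟨fun hall j hj => ?_, fun hall j hj => hall j (by omega)⟩
      rcases Nat.lt_succ_iff_lt_or_eq.1 hj with hj | rfl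
      exacts [hall j hj, hbt]

/-- Verify that the output is a Hamilton cycle, and set the success flag. -/
def verifyProgram (d : ℕ) : Program :=
  .seq (.ite (.natLe (.const 3) .size) (.setNat 34 (.const 0) (.const 1))
    (.setNat 34 (.const 0) (.const 0)))
  (.seq (rejectProgram (.natEq (.get 9 (scalar 22)) (.const 0)))
  (.seq (rejectProgram (nonAdjTest d (.get 1 (scalar 22)) (.get 1 (.add (scalar 22) (.const 1)))))
    (.ite (.natEq (scalar 34) (.const 0)) (.setNat 0 (.const 0) (.const 0))
      (.setNat 0 (.const 0) (.const 1)))))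

theorem runs_verify {σ : Store} (hn : 1 ≤ n) (hW : n ≤ W) :
    Runs I W (verifyProgram d) σ (n * 8 + 8) (fun τ =>
      (τ.Success ↔ 3 ≤ n ∧ (∀ u < n, σ.nat 9 u ≠ 0) ∧ ∀ i < n,
        I.EdgeN (σ.nat 1 i) (σ.nat 1 (i + 1)) ∨ I.NearN (σ.nat 1 i) (σ.nat 1 (i + 1))) ∧
      τ.nat 1 = σ.nat 1) := by
  refine (Runs.seq (S := 2) (T := n * 8 + 6) (R := fun τ =>
    (τ.nat 34 0 ≠ 0 ↔ 3 ≤ n) ∧ ∀ c, c ≠ 34 → τ.nat c = σ.nat c) ?_ ?_).mono (by omega)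
    (fun _ h => h)
  · refine Runs.ite (fun hb => Runs.setNat (by simp; omega) ?_)
      (fun hb => Runs.setNat (by simp) ?_) <;>
      simp only [Test.Holds, NatExpr.eval_const, NatExpr.eval_size] at hb
    · exact ⟨by simp [hb], fun c hc => by simp [hc]⟩
    · exact ⟨by simp; omega, fun c hc => by simp [hc]⟩
  rintro τ ⟨t2, t3⟩
  refine (Runs.seq (T := n * 4 + 4) (runs_reject (P := fun u => σ.nat 9 u = 0) hW ?_) ?_).mono
    (by omega) (fun _ h => h)
  · intro i _ υ h22 hυ
    simp [h22, hυ 9, t3 9]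
  rintro υ ⟨u1, u2⟩
  refine Runs.seq (T := 2) (runs_reject (P := fun i => ¬ (I.EdgeN (σ.nat 1 i) (σ.nat 1 (i + 1)) ∨
    I.NearN (σ.nat 1 i) (σ.nat 1 (i + 1)))) hW ?_) ?_
  · intro i _ ω h22 hω
    rw [holds_nonAdjTest]
    simp [h22, hω 1, u2 1, t3 1]
  rintro ω ⟨w1, w2⟩
  have hflag : ω.nat 34 0 ≠ 0 ↔ 3 ≤ n ∧ (∀ u < n, σ.nat 9 u ≠ 0) ∧ ∀ i < n,
      I.EdgeN (σ.nat 1 i) (σ.nat 1 (i + 1)) ∨ I.NearN (σ.nat 1 i) (σ.nat 1 (i + 1)) := by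
    rw [w1, u1, t2, and_assoc]
    simp only [not_not, ne_eq]
  have h1 : ω.nat 1 = σ.nat 1 := by
    rw [w2 1 (by simp) (by simp), u2 1 (by simp) (by simp), t3 1 (by simp)]
  rw [← hflag]
  refine Runs.ite (fun hb => Runs.setNat (by simp) ?_)
    (fun hb => Runs.setNat (by simp; omega) ?_) <;>
    simp only [Test.holds_natEq, NatExpr.eval_get, NatExpr.eval_const] at hb
  · exact ⟨by simp [Store.Success, hb], by simp [h1]⟩
  · exact ⟨by simp [Store.Success, hb], by simp [h1]⟩

/-- The entries of the output array are a Hamilton cycle if they exhaust the vertices and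
consecutive entries are adjacent. -/
theorem Store.listsHamiltonCycle {σ : Store} {G : SimpleGraph (Fin n)} {f : Fin n → Fin n}
    (hn : 3 ≤ n) (hσ : ∀ i : Fin n, σ.nat 1 i = f i) (hf : Function.Bijective f)
    (hadj : ∀ i j : Fin n, (i : ℕ) + 1 = j ∨ ((i : ℕ) + 1 = n ∧ (j : ℕ) = 0) → G.Adj (f i) (f j)) :
    σ.ListsHamiltonCycle G := by
  obtain ⟨k, rfl⟩ : ∃ k, n = k + 3 := ⟨n - 3, by omega⟩
  have key : ∀ i j : Fin (k + 3), i - j = 1 → G.Adj (f i) (f j) := by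
    intro i j hij
    have hi : i = j + 1 := by rw [← hij]; abel
    refine (hadj j i ?_).symm
    subst hi
    rcases Nat.lt_or_ge (j + 1) (k + 3) with h | h
    · left
      rw [Fin.val_add_one_of_lt' h]
    · right
      have : j = Fin.last (k + 2) := Fin.ext (by simp; omega)
      subst this
      simp
  -- The cycle is the image of the standard cycle under the injective homomorphism `f`. The standard
  -- cycle lists its vertices downwards, hence the reversal below.
  let φ : SimpleGraph.cycleGraph (k + 3) →g G :=
    ⟨f, fun {i j} h => by
      rcases SimpleGraph.cycleGraph_adj.1 h with h | h
      · exact key i j h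
      · exact (key j i h).symm⟩
  have hcyc : ((SimpleGraph.cycleGraph.cycle k).map φ).IsCycle :=
    SimpleGraph.cycleGraph.isCycle_cycle.map hf.injective
  refine ⟨_, ((SimpleGraph.cycleGraph.cycle k).map φ).reverse, ?_, ?_⟩
  · rw [SimpleGraph.Walk.isHamiltonianCycle_iff_isCycle_and_length_eq]
    exact ⟨hcyc.reverse, by simp⟩
  · intro i hi
    rw [SimpleGraph.Walk.getVert_reverse, SimpleGraph.Walk.getVert_map,
      SimpleGraph.Walk.length_map, SimpleGraph.cycleGraph.length_cycle,
      SimpleGraph.cycleGraph.getVert_cycle (by omega)]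
    have := hσ ⟨i, hi⟩
    rw [this]
    congr 2
    ext
    simp only [show k + 3 - (k + 3 - i) = i by omega, Nat.mod_eq_of_lt hi]

/-- The machine compares squares, having no square root; positivity of the radius allows a return to
norms. -/
theorem Input.union_adj {u v : ℕ} (hr : 0 < I.radius) (hu : u < n) (hv : v < n) (hne : u ≠ v)
    (h : I.EdgeN u v ∨ I.NearN u v) : I.union.Adj ⟨u, hu⟩ ⟨v, hv⟩ := by
  rcases h with ⟨_, _, h⟩ | h
  · exact Or.inl h
  · refine Or.inr ⟨fun e => hne (by simpa using e), ?_⟩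
    rw [Input.NearN, Finset.sum_range] at h
    rw [EuclideanSpace.norm_eq]
    refine Real.sqrt_le_iff.2 ⟨hr.le, ?_⟩
    rw [sq I.radius]
    refine le_of_eq_of_le (Finset.sum_congr rfl fun k _ => ?_) h
    simp [Input.coordN, hu, hv]

end output

/-! ### The whole algorithm -/

section whole

variable {d n : ℕ} {I : Input d n}

/-- The algorithm, for points in dimension `d` and cells with about `L` points on average. -/
def hamiltonProgram (d L : ℕ) : Program :=
  .seq (gridProgram d L)
  (.seq (.forN 22 (cellProgram d))
  (.seq (.forN 22 linkProgram)
  (.seq (.forN 22 processProgram)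
  (.seq walkProgram (verifyProgram d)))))

/-- Both claims concern the same run. The first rests on the final check alone, the second on the
invariants of the merging loop. -/
theorem runs_hamiltonProgram {L : ℕ} (hd : 1 ≤ d) (hL : 1 ≤ L) (hn : 1 ≤ n)
    (hr : 0 < I.radius) :
    Runs I (n + 1) (hamiltonProgram d L) Store.init ((5 * d + 100) * n ^ 2) (fun τ =>
      (τ.Success → τ.ListsHamiltonCycle I.union) ∧
      ∀ m N, (m = 0 ∨ L * m ^ d ≤ n) → n < L * (m + 1) ^ d → 3 ≤ n →
        WellSpread n N I.EdgeN (I.cellN m) →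
        (∀ u < n, ∀ v < n, I.cellN m u = I.cellN m v → I.NearN u v) → τ.Success) := by
  refine Runs.mono (T := (n * 2 + 1) + ((n * (d * (n * 2 + 3) + 3) + 2) + ((n * 10 + 2) +
    ((n * (n * 15 + 34) + 2) + ((n * 5 + 4) + (n * 8 + 8))))))
    (Runs.seq (runs_gridProgram hd hL (by omega)) ?_) ?_ (fun _ h => h)
  swap
  · have h1 : n ≤ n ^ 2 := Nat.le_self_pow (by omega) n
    have h2 : n * d ≤ n ^ 2 * d := Nat.mul_le_mul_right d h1
    nlinarith
  rintro σ₁ ⟨m, hm, hm', s20, s0⟩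
  have hmn : m ≤ n := by
    rcases hm with rfl | hm
    · omega
    · calc m ≤ m ^ d := Nat.le_self_pow (by omega) _
        _ ≤ L * m ^ d := Nat.le_mul_of_pos_left _ hL
        _ ≤ n := hm
  refine Runs.seq (runs_cells (by omega) hmn hL hm s20 s0) ?_
  rintro σ₂ ⟨c1, c0⟩
  have hcell : ∀ u < n, σ₂.nat 4 u < n := fun u hu => by
    rw [c1 u hu]; exact I.cellN_lt hL hm hu
  refine Runs.seq (runs_link I.EdgeN le_rfl hcell c0) ?_
  rintro σ₃ ⟨l4, lcov, lhead, l5, l6, l9⟩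
  have hcell₃ : ∀ u < n, σ₃.nat 4 u < n := by rwa [l4]
  refine Runs.seq (runs_processAll (by omega) hcell₃ lhead ⟨rfl, rfl, l9,
    fun u hu => by rw [l5 _ (hcell₃ u hu)]; exact hcell₃ u hu, lcov,
    fun N _ => Progress.init (by simp [l6])⟩) ?_
  rintro σ₄ ⟨-, -, m9, -, mcov, mprog⟩
  refine Runs.seq (runs_walk hn (by omega) mcov.next_lt m9) ?_
  rintro σ₅ ⟨w1, wn, wv⟩
  refine (runs_verify hn (by omega)).mono le_rfl ?_
  rintro τ ⟨hs, h1⟩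
  have hit : ∀ i, (σ₄.nat 2)^[i] 0 < n := by
    intro i
    induction i with
    | zero => exact hn
    | succ i ih => rw [Function.iterate_succ_apply']; exact mcov.next_lt _ ih
  have inj_of : (∀ u < n, ∃ i < n, (σ₄.nat 2)^[i] 0 = u) →
      Function.Bijective fun i : Fin n => (⟨(σ₄.nat 2)^[i] 0, hit i⟩ : Fin n) := by
    intro h
    refine Finite.injective_iff_bijective.1 (Finite.injective_iff_surjective.2 fun u => ?_)
    obtain ⟨i, hi, e⟩ := h u u.2
    exact ⟨⟨i, hi⟩, Fin.ext e⟩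
  constructor
  · intro hsucc
    obtain ⟨h3, hv, ha⟩ := hs.1 hsucc
    have hvis : ∀ u < n, ∃ i < n, (σ₄.nat 2)^[i] 0 = u := fun u hu =>
      not_not.1 fun e => hv u hu ((wv u).2 e)
    have hbij := inj_of hvis
    refine Store.listsHamiltonCycle h3 (fun i => by rw [h1, w1 i i.2]) hbij ?_
    rintro i j hij
    have hne : (σ₄.nat 2)^[i] 0 ≠ (σ₄.nat 2)^[j] 0 := fun e => by
      have : i = j := hbij.1 (Fin.ext e)
      subst this
      omega
    refine Input.union_adj hr _ _ hne ?_
    have hai := ha i i.2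
    rw [w1 i i.2] at hai
    rcases hij with e | ⟨e, e'⟩
    · rwa [e, w1 j j.2] at hai
    · rw [e, wn] at hai
      rwa [e']
  · intro m' N hm₁ hm₂ h3 hws hnear
    -- The two inequalities determine the grid size, as `L * m ^ d` is monotone in `m`.
    obtain rfl : m' = m := by
      rcases lt_trichotomy m' m with h | h | h
      · rcases hm with rfl | hm
        · omega
        · have := Nat.mul_le_mul_left L (Nat.pow_le_pow_left h d)
          simp only [Nat.succ_eq_add_one] at this
          omega
      · exact h
      · rcases hm₁ with rfl | hm₁
        · omega
        · have := Nat.mul_le_mul_left L (Nat.pow_le_pow_left h d)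
          simp only [Nat.succ_eq_add_one] at this
          omega
    have hc : ∀ u < n, σ₃.nat 4 u = I.cellN m' u := by rw [l4]; exact c1
    have hcomp := (mprog N (hws.congr hc)).comp_eq hcell₃
    have hvis := mcov.exists_iterate hn hcomp
    have hbij := inj_of hvis
    refine hs.2 ⟨h3, fun u hu e => (wv u).1 e (hvis u hu), fun i hi => ?_⟩
    have hstep : ∀ u < n, I.EdgeN u (σ₄.nat 2 u) ∨ I.NearN u (σ₄.nat 2 u) := fun u hu => by
      refine (mcov.step u hu).imp_right fun e => ?_
      rw [hc u hu, hc _ (mcov.next_lt u hu)] at e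
      exact hnear u hu _ (mcov.next_lt u hu) e
    have hi' := hstep _ (hit i)
    rw [w1 i hi]
    rcases Nat.lt_or_ge (i + 1) n with h | h
    · rwa [w1 _ h, Function.iterate_succ_apply']
    · obtain rfl : i + 1 = n := by omega
      rw [wn]
      -- The successor of the last entry is the `j`-th entry for some `j < n`. If `j = l + 1`,
      -- injectivity of `next` would give `l = i` and `j = n`; so it is the entry `0`.
      obtain ⟨j, hj, e⟩ := hvis _ (mcov.next_lt _ (hit i))
      rcases Nat.eq_zero_or_pos j with rfl | hj0
      · rwa [← e] at hi'
      · exfalso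
        obtain ⟨l, rfl⟩ : ∃ l, j = l + 1 := ⟨j - 1, by omega⟩
        rw [Function.iterate_succ_apply'] at e
        have e' := congrArg (σ₄.nat 3) e
        rw [mcov.prev_next _ (hit l), mcov.prev_next _ (hit i)] at e'
        have := hbij.1 (a₁ := ⟨l, by omega⟩) (a₂ := ⟨i, hi⟩) (Fin.ext e')
        have := congrArg Fin.val this
        simp only at this
        omega

end whole

/-! ### The grid cells of random points -/

section grid

variable {d n : ℕ}

/-- The grid cell of a point. -/
noncomputable def cellIndex (d m : ℕ) (p : EuclideanSpace ℝ (Fin d)) : ℕ :=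
  ∑ k : Fin d, digit m (p k) * m ^ (k : ℕ)

theorem Input.cellN_eq (I : Input d n) (m : ℕ) {u : ℕ} (hu : u < n) :
    I.cellN m u = cellIndex d m (I.pos ⟨u, hu⟩) := by
  rw [Input.cellN, cellIndex, Finset.sum_range]
  exact Finset.sum_congr rfl fun k _ => by simp [Input.coordN, hu]

theorem measurable_cellIndex (m : ℕ) : Measurable (cellIndex d m) := by
  unfold cellIndex digit
  refine Finset.measurable_sum _ fun k _ => Measurable.mul_const ?_ _
  refine Measurable.min ?_ measurable_const
  exact Nat.measurable_floor.comp (by fun_prop)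

theorem digit_lt {m : ℕ} (hm : 1 ≤ m) (t : ℝ) : digit m t < m :=
  (min_le_right _ _).trans_lt (by omega)

theorem cellIndex_eq {m : ℕ} (hm : 1 ≤ m) (p : EuclideanSpace ℝ (Fin d)) :
    cellIndex d m p = finFunctionFinEquiv fun k => (⟨digit m (p k), digit_lt hm _⟩ : Fin m) := by
  rw [finFunctionFinEquiv_apply, cellIndex]

theorem cellIndex_lt {m : ℕ} (hm : 1 ≤ m) (p : EuclideanSpace ℝ (Fin d)) :
    cellIndex d m p < m ^ d := by
  rw [cellIndex_eq hm]
  exact Fin.is_lt _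

theorem digit_eq_of_cellIndex_eq {m : ℕ} (hm : 1 ≤ m) {p q : EuclideanSpace ℝ (Fin d)}
    (h : cellIndex d m p = cellIndex d m q) (k : Fin d) : digit m (p k) = digit m (q k) := by
  rw [cellIndex_eq hm, cellIndex_eq hm] at h
  have := congrFun (finFunctionFinEquiv.injective (Fin.ext h)) k
  simpa using this

theorem digit_le_mul {m : ℕ} {t : ℝ} (ht : t ∈ Set.Icc (0 : ℝ) 1) : (digit m t : ℝ) ≤ m * t := by
  calc (digit m t : ℝ) ≤ ⌊m * t⌋₊ := by exact_mod_cast min_le_left _ _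
    _ ≤ m * t := Nat.floor_le (mul_nonneg (by positivity) ht.1)

theorem mul_le_digit {m : ℕ} (hm : 1 ≤ m) {t : ℝ} (ht : t ∈ Set.Icc (0 : ℝ) 1) :
    m * t ≤ digit m t + 1 := by
  rw [digit]
  rcases le_total ⌊m * t⌋₊ (m - 1) with h | h
  · rw [min_eq_left h]
    exact (Nat.lt_floor_add_one _).le
  · rw [min_eq_right h]
    have : ((m - 1 : ℕ) : ℝ) + 1 = m := by exact_mod_cast Nat.sub_add_cancel hm
    rw [this]
    exact mul_le_of_le_one_right (by positivity) ht.2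

theorem abs_sub_le_of_digit_eq {m : ℕ} (hm : 1 ≤ m) {s t : ℝ} (hs : s ∈ Set.Icc (0 : ℝ) 1)
    (ht : t ∈ Set.Icc (0 : ℝ) 1) (h : digit m s = digit m t) : |s - t| ≤ 1 / m := by
  have hm' : (0 : ℝ) < m := by exact_mod_cast hm
  have h1 := digit_le_mul (m := m) hs
  have h2 := digit_le_mul (m := m) ht
  have h3 := mul_le_digit hm hs
  have h4 := mul_le_digit hm ht
  rw [h] at h1 h3
  have h5 : |(s - t) * m| ≤ 1 := abs_le.2 ⟨by linarith, by linarith⟩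
  rw [le_div_iff₀ hm']
  rwa [abs_mul, abs_of_pos hm'] at h5

/-- A cell has diameter at most `√d / m`; the cruder `d / m` avoids the root. -/
theorem near_of_cellN_eq {I : Input d n} {m : ℕ} (hm : 1 ≤ m) (hI : ∀ i, I.pos i ∈ unitCube d)
    (hr : (d : ℝ) / m ≤ I.radius) {u v : ℕ} (hu : u < n) (hv : v < n)
    (h : I.cellN m u = I.cellN m v) : I.NearN u v := by
  have hm' : (0 : ℝ) < m := by exact_mod_cast hm
  rw [I.cellN_eq m hu, I.cellN_eq m hv] at h
  rw [Input.NearN, Finset.sum_range]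
  calc ∑ k : Fin d, (I.coordN u k - I.coordN v k) ^ 2 ≤ ∑ _k : Fin d, (1 / m : ℝ) ^ 2 := by
        refine Finset.sum_le_sum fun k _ => ?_
        rw [← sq_abs]
        refine pow_le_pow_left₀ (abs_nonneg _) ?_ 2
        simpa [Input.coordN, hu, hv] using
          abs_sub_le_of_digit_eq hm (hI ⟨u, hu⟩ k) (hI ⟨v, hv⟩ k) (digit_eq_of_cellIndex_eq hm h k)
    _ = d * (1 / m : ℝ) ^ 2 := by simp
    _ ≤ (d : ℝ) ^ 2 * (1 / m : ℝ) ^ 2 := by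
        refine mul_le_mul_of_nonneg_right ?_ (by positivity)
        exact_mod_cast Nat.le_self_pow (by omega) d
    _ = (d / m : ℝ) * (d / m) := by ring
    _ ≤ I.radius * I.radius := mul_self_le_mul_self (by positivity) hr

/-- A lower bound is enough, so only the half-open box is considered and the faces added by the cap
in `digit` play no role. -/
theorem le_uniformCube_cell {m q : ℕ} (hm : 1 ≤ m) (hq : q < m ^ d) :
    ENNReal.ofReal ((1 / m : ℝ) ^ d) ≤ uniformCube d {p | cellIndex d m p = q} := by
  have hm' : (0 : ℝ) < m := by exact_mod_cast hm
  set f := finFunctionFinEquiv.symm (⟨q, hq⟩ : Fin (m ^ d)) with hf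
  set J : Fin d → Set ℝ := fun k => Set.Ico ((f k : ℝ) / m) (((f k : ℕ) + 1 : ℝ) / m) with hJ
  have hs : MeasurableSet (Set.pi Set.univ J) := MeasurableSet.univ_pi fun _ => measurableSet_Ico
  have h := (PiLp.volume_preserving_ofLp (Fin d)).measure_preimage hs.nullMeasurableSet
  have hvol : volume (Set.pi Set.univ J) = ENNReal.ofReal ((1 / m : ℝ) ^ d) := by
    rw [volume_pi_pi]
    simp only [hJ, Real.volume_Ico]
    have : ∀ k : Fin d, ((f k : ℕ) + 1 : ℝ) / m - (f k : ℝ) / m = 1 / m := fun k => by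
      rw [← sub_div]; congr 1; ring
    simp only [this, Finset.prod_const, Finset.card_univ, Fintype.card_fin]
    rw [ENNReal.ofReal_pow (by positivity)]
  have hcell : MeasurableSet {p : EuclideanSpace ℝ (Fin d) | cellIndex d m p = q} :=
    measurable_cellIndex m (measurableSet_singleton q)
  rw [← hvol, ← h, uniformCube, Measure.restrict_apply hcell]
  refine measure_mono fun p hp => ?_
  have hp' : ∀ k, p k ∈ J k := fun k => hp k trivial
  have hb : ∀ k, (f k : ℝ) ≤ m * p k ∧ m * p k < (f k : ℕ) + 1 := fun k => by
    have := hp' k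
    rw [hJ, Set.mem_Ico, div_le_iff₀ hm', lt_div_iff₀ hm'] at this
    rwa [mul_comm]
  have hdig : ∀ k, digit m (p k) = f k := fun k => by
    have : ⌊m * p k⌋₊ = f k := by
      rw [Nat.floor_eq_iff ((Nat.cast_nonneg _).trans (hb k).1)]
      exact hb k
    rw [digit, this, min_eq_left]
    have := (f k).2
    omega
  constructor
  · change cellIndex d m p = q
    rw [cellIndex_eq hm]
    have : (fun k => (⟨digit m (p k), digit_lt hm _⟩ : Fin m)) = f :=
      funext fun k => Fin.ext (hdig k)
    rw [this, hf, Equiv.apply_symm_apply]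
  · intro k
    constructor
    · have := (Nat.cast_nonneg (α := ℝ) (f k : ℕ)).trans (hb k).1
      exact nonneg_of_mul_nonneg_right this hm'
    · have h1 : ((f k : ℕ) + 1 : ℝ) ≤ m := by exact_mod_cast (f k).2
      have h2 := (hb k).2.le.trans h1
      by_contra hcon
      nlinarith

theorem le_uniformCube_cells {m : ℕ} (hm : 1 ≤ m) {B : Finset ℕ} (hB : B ⊆ Finset.range (m ^ d)) :
    (B.card : ℝ) / (m : ℝ) ^ d ≤ (uniformCube d).real {p | cellIndex d m p ∈ B} := by
  have hset : {p | cellIndex d m p ∈ B} = ⋃ q ∈ B, {p | cellIndex d m p = q} := by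
    ext p; simp
  rw [hset, measureReal_biUnion_finset]
  · rw [div_eq_mul_one_div, ← nsmul_eq_mul, ← one_div_pow]
    refine Finset.card_nsmul_le_sum _ _ _ fun q hq => ?_
    rw [measureReal_def, ← ENNReal.ofReal_le_iff_le_toReal (measure_ne_top _ _)]
    exact le_uniformCube_cell hm (Finset.mem_range.1 (hB hq))
  · intro q _ q' _ hne
    rw [Function.onFun, Set.disjoint_left]
    rintro p rfl h
    exact hne h
  · exact fun q _ => measurable_cellIndex m (measurableSet_singleton q)

end grid

/-! ### Concentration -/

section concentration

variable {d n : ℕ}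

open Classical in
/-- A Chernoff bound: if a set has measure at least `1 / 9`, then it is unlikely that it receives
only few of the given random points. -/
theorem randomPoints_few_le {A : Set (EuclideanSpace ℝ (Fin d))} (hA : MeasurableSet A)
    (hA' : 1 / 9 ≤ (uniformCube d).real A) (S : Finset (Fin n)) (t : ℕ) :
    (randomPoints d n).real {x | (S.filter fun v => x v ∈ A).card ≤ t} ≤
      2 ^ t * (17 / 18) ^ S.card := by
  -- The product of these factors is `2 ^ (-X)`, where `X` counts the points of `S` in `A`. Each
  -- factor with `v ∈ S` has mean at most `1 - 1 / 18`, and Markov's inequality is applied at `2 ^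
  -- (-t)`.
  set f : Fin n → EuclideanSpace ℝ (Fin d) → ℝ :=
    fun v => if v ∈ S then fun p => 1 - A.indicator (fun _ => (1 / 2 : ℝ)) p else fun _ => 1 with hf
  have hint : ∀ v, Integrable (f v) (uniformCube d) := by
    intro v
    by_cases hv : v ∈ S
    · simp only [hf, hv, if_true]
      exact (integrable_const _).sub ((integrable_const _).indicator hA)
    · simp only [hf, hv, if_false]
      exact integrable_const _
  have hval : ∀ v, ∫ p, f v p ∂(uniformCube d) ≤ if v ∈ S then 17 / 18 else 1 := by
    intro v
    by_cases hv : v ∈ S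
    · simp only [hf, hv, if_true]
      rw [integral_sub (integrable_const _) ((integrable_const _).indicator hA),
        integral_indicator_const _ hA]
      simp only [integral_const, probReal_univ, smul_eq_mul]
      linarith
    · simp [hf, hv]
  have hnn : ∀ v p, 0 ≤ f v p := by
    intro v p
    by_cases hv : v ∈ S
    · by_cases hp : p ∈ A <;> (simp [hf, hv, hp]; try norm_num)
    · simp [hf, hv]
  have hprod : ∀ x : Fin n → EuclideanSpace ℝ (Fin d),
      ∏ v, f v (x v) = (1 / 2) ^ (S.filter fun v => x v ∈ A).card := by
    intro x
    rw [← Finset.prod_const, Finset.prod_filter, ← Finset.prod_subset (Finset.subset_univ S)]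
    · refine Finset.prod_congr rfl fun v hv => ?_
      by_cases hp : x v ∈ A <;> simp [hf, hv, hp]
      norm_num
    · intro v _ hv
      simp [hf, hv]
  have hI : ∫ x, ∏ v, f v (x v) ∂(randomPoints d n) ≤ (17 / 18) ^ S.card := by
    rw [randomPoints, integral_fintype_prod_eq_prod]
    calc ∏ v, ∫ p, f v p ∂(uniformCube d) ≤ ∏ v, if v ∈ S then (17 / 18 : ℝ) else 1 :=
          Finset.prod_le_prod (fun v _ => integral_nonneg (hnn v)) fun v _ => hval v
      _ = (17 / 18) ^ S.card := by
          rw [Finset.prod_ite_mem, Finset.univ_inter, Finset.prod_const]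
  have hM := mul_meas_ge_le_integral_of_nonneg (μ := randomPoints d n)
    (f := fun x => ∏ v, f v (x v))
    (Eventually.of_forall fun x => Finset.prod_nonneg fun v _ => hnn v _)
    (Integrable.fintype_prod hint) ((1 / 2) ^ t)
  have hsub : (randomPoints d n).real {x | (S.filter fun v => x v ∈ A).card ≤ t} ≤
      (randomPoints d n).real {x | (1 / 2 : ℝ) ^ t ≤ ∏ v, f v (x v)} := by
    refine measureReal_mono fun x hx => ?_
    change (1 / 2 : ℝ) ^ t ≤ ∏ v, f v (x v)
    rw [hprod]
    exact pow_le_pow_of_le_one (by norm_num) (by norm_num) hx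
  calc _ ≤ (randomPoints d n).real {x | (1 / 2 : ℝ) ^ t ≤ ∏ v, f v (x v)} := hsub
    _ = 2 ^ t * ((1 / 2) ^ t * (randomPoints d n).real {x | (1 / 2 : ℝ) ^ t ≤ ∏ v, f v (x v)}) := by
        rw [← mul_assoc, ← mul_pow]; norm_num
    _ ≤ 2 ^ t * (17 / 18) ^ S.card := by
        refine mul_le_mul_of_nonneg_left (hM.trans hI) (by positivity)

open Classical in
/-- With high probability, every vertex of a graph of large minimum degree has at least `20`
neighbours in most cells of the grid. -/
theorem randomPoints_not_wellSpread_le {m D : ℕ} (hm : 1 ≤ m) (H : SimpleGraph (Fin n))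
    (hH : ∀ v, D ≤ (Finset.univ.filter fun u => H.Adj v u).card) (ρ : ℝ) :
    (randomPoints d n).real {x | ¬ WellSpread n (m ^ d) (Input.mk H x ρ).EdgeN
      ((Input.mk H x ρ).cellN m)} ≤ n * (2 ^ (21 * m ^ d) * (17 / 18) ^ D) := by
  set N := m ^ d with hN
  have hN0 : 0 < N := pow_pos hm d
  -- The union bound runs over a vertex and the set `B` of its poor cells. The neighbours falling
  -- into `B` number at most `20 * B.card ≤ 20 * N`; the at most `2 ^ N` choices of `B` turn the
  -- exponent `20 * N` into `21 * N`.
  set Bs := (Finset.range N).powerset.filter fun B => N ≤ 9 * B.card with hBs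
  let G : Fin n × Finset ℕ → Set (Fin n → EuclideanSpace ℝ (Fin d)) := fun z =>
    {x | ((Finset.univ.filter fun u => H.Adj z.1 u).filter
      fun u => x u ∈ {p | cellIndex d m p ∈ z.2}).card ≤ 20 * N}
  have hsub : {x | ¬ WellSpread n N (Input.mk H x ρ).EdgeN ((Input.mk H x ρ).cellN m)} ⊆
      ⋃ z ∈ (Finset.univ : Finset (Fin n)) ×ˢ Bs, G z := by
    intro x hx
    by_contra hcon
    refine hx ⟨hN0, fun u hu => ?_, fun v hv => ?_⟩
    · rw [Input.cellN_eq _ m hu]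
      exact cellIndex_lt hm _
    · by_contra hlt
      set B := (Finset.range N).filter fun q => ((Finset.range n).filter fun u =>
        (Input.mk H x ρ).EdgeN v u ∧ (Input.mk H x ρ).cellN m u = q).card < 20
      refine hcon (Set.mem_iUnion₂.2 ⟨(⟨v, hv⟩, B), ?_, ?_⟩)
      · simp only [hBs, Finset.mem_product, Finset.mem_univ, true_and, Finset.mem_filter,
          Finset.mem_powerset]
        exact ⟨Finset.filter_subset _ _, by omega⟩
      · change Finset.card _ ≤ _
        refine (Finset.card_eq_sum_card_fiberwise (f := fun u => cellIndex d m (x u)) (t := B)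
          (fun u hu => (Finset.mem_filter.1 (Finset.mem_coe.1 hu)).2)).trans_le ?_
        calc _ ≤ ∑ q ∈ B, 20 := by
              refine Finset.sum_le_sum fun q hq => ?_
              refine le_trans ?_ (Finset.mem_filter.1 hq).2.le
              refine Finset.card_le_card_of_injOn Fin.val ?_ Fin.val_injective.injOn
              intro u hu
              simp only [Finset.coe_filter, Finset.mem_filter, Finset.mem_univ, true_and,
                Set.mem_ofPred_eq] at hu
              simp only [Finset.coe_filter, Finset.mem_range, Set.mem_ofPred_eq]
              exact ⟨u.2, ⟨hv, u.2, hu.1.1⟩, by rw [Input.cellN_eq _ m u.2]; exact hu.2⟩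
          _ = 20 * B.card := by simp [mul_comm]
          _ ≤ 20 * N := by
              refine Nat.mul_le_mul_left _ ?_
              simpa using Finset.card_le_card (Finset.filter_subset _ (Finset.range N))
  have hcard : (Bs.card : ℝ) ≤ 2 ^ N := by
    have : Bs.card ≤ 2 ^ N := by
      refine (Finset.card_filter_le _ _).trans ?_
      rw [Finset.card_powerset, Finset.card_range]
    exact_mod_cast this
  have hG : ∀ z ∈ (Finset.univ : Finset (Fin n)) ×ˢ Bs,
      (randomPoints d n).real (G z) ≤ (2 : ℝ) ^ (20 * N) * (17 / 18) ^ D := by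
    intro z hz
    simp only [hBs, Finset.mem_product, Finset.mem_univ, true_and, Finset.mem_filter,
      Finset.mem_powerset] at hz
    have hmeas : MeasurableSet {p : EuclideanSpace ℝ (Fin d) | cellIndex d m p ∈ z.2} :=
      measurable_cellIndex m z.2.measurableSet
    have hlarge : 1 / 9 ≤ (uniformCube d).real {p | cellIndex d m p ∈ z.2} := by
      refine le_trans ?_ (le_uniformCube_cells hm hz.1)
      have h1 : (N : ℝ) ≤ 9 * z.2.card := by exact_mod_cast hz.2
      have h2 : (0 : ℝ) < (m : ℝ) ^ d := by positivity
      rw [le_div_iff₀ h2]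
      have h3 : (N : ℝ) = (m : ℝ) ^ d := by rw [hN]; push_cast; rfl
      linarith
    have hfew := randomPoints_few_le hmeas hlarge (Finset.univ.filter fun u => H.Adj z.1 u) (20 * N)
    refine le_trans (le_of_eq_of_le (congrArg _ ?_) hfew) ?_
    · ext x
      change Finset.card _ ≤ _ ↔ Finset.card _ ≤ _
      congr!
    refine mul_le_mul_of_nonneg_left ?_ (by positivity)
    exact pow_le_pow_of_le_one (by norm_num) (by norm_num) (hH z.1)
  calc _ ≤ (randomPoints d n).real (⋃ z ∈ (Finset.univ : Finset (Fin n)) ×ˢ Bs, G z) :=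
        measureReal_mono hsub (measure_ne_top _ _)
    _ ≤ ∑ z ∈ (Finset.univ : Finset (Fin n)) ×ˢ Bs, (randomPoints d n).real (G z) :=
        measureReal_biUnion_finset_le _ _
    _ ≤ ∑ z ∈ (Finset.univ : Finset (Fin n)) ×ˢ Bs, (2 : ℝ) ^ (20 * N) * (17 / 18) ^ D :=
        Finset.sum_le_sum hG
    _ = (n * Bs.card) * ((2 : ℝ) ^ (20 * N) * (17 / 18) ^ D) := by
        rw [Finset.sum_const, Finset.card_product, Finset.card_univ, Fintype.card_fin, nsmul_eq_mul,
          Nat.cast_mul]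
    _ ≤ (n * 2 ^ N) * ((2 : ℝ) ^ (20 * N) * (17 / 18) ^ D) :=
        mul_le_mul_of_nonneg_right (mul_le_mul_of_nonneg_left hcard n.cast_nonneg)
          (mul_nonneg (pow_nonneg zero_le_two _) (pow_nonneg (by norm_num) _))
    _ = n * (2 ^ (21 * N) * (17 / 18) ^ D) := by
        rw [show 21 * N = N + 20 * N by omega, pow_add, mul_assoc, mul_assoc]

theorem ae_mem_unitCube (d n : ℕ) : ∀ᵐ x ∂(randomPoints d n), ∀ i : Fin n, x i ∈ unitCube d := by
  rw [ae_all_iff]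
  intro i
  have hmeas : MeasurableSet (unitCube d) := by
    have : unitCube d = ⋂ k, (fun x : EuclideanSpace ℝ (Fin d) => x k) ⁻¹' Set.Icc 0 1 := by
      ext x; simp [unitCube]
    rw [this]
    exact MeasurableSet.iInter fun k => (by fun_prop : Measurable fun x : EuclideanSpace ℝ (Fin d) =>
      x k) measurableSet_Icc
  have h : ∀ᵐ p ∂(uniformCube d), p ∈ unitCube d := ae_restrict_mem hmeas
  exact (Measure.quasiMeasurePreserving_eval (fun _ : Fin n => uniformCube d) i).ae h

/-- Only subadditivity is used, so the events need not be measurable. -/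
theorem AAS.of_compl_le {E : ∀ n : ℕ, (Fin n → EuclideanSpace ℝ (Fin d)) → Prop} {δ : ℕ → ℝ}
    (hδ : Tendsto δ atTop (𝓝 0))
    (h : ∀ᶠ n in atTop, (randomPoints d n).real {x | ¬ E n x} ≤ δ n) : AAS d E := by
  have hlim : Tendsto (fun n => 1 - ENNReal.ofReal (δ n)) atTop (𝓝 1) := by
    have := ENNReal.Tendsto.sub (tendsto_const_nhds (x := (1 : ENNReal)))
      (ENNReal.tendsto_ofReal hδ) (.inl (by simp))
    simpa using this
  refine tendsto_of_tendsto_of_tendsto_of_le_of_le' hlim tendsto_const_nhds ?_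
    (Eventually.of_forall fun n => prob_le_one)
  filter_upwards [h] with n hn
  rw [tsub_le_iff_right]
  calc (1 : ENNReal) = randomPoints d n ({x | E n x} ∪ {x | ¬ E n x}) := by
        have : {x | E n x} ∪ {x | ¬ E n x} = Set.univ := Set.union_compl_self {x | E n x}
        rw [this, measure_univ]
    _ ≤ _ := measure_union_le _ _
    _ ≤ _ := by
        refine add_le_add_right ?_ _
        rw [ENNReal.le_ofReal_iff_toReal_le (measure_ne_top _ _)
          (measureReal_nonneg.trans hn)]
        exact hn

theorem AAS.mono {E F : ∀ n : ℕ, (Fin n → EuclideanSpace ℝ (Fin d)) → Prop} (hE : AAS d E)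
    (h : ∀ n x, E n x → F n x) : AAS d F :=
  tendsto_of_tendsto_of_tendsto_of_le_of_le hE tendsto_const_nhds
    (fun n => measure_mono fun x hx => h n x hx) fun _ => prob_le_one

end concentration

/-! ### The constants, and success of the algorithm with high probability -/

section main

variable {d n : ℕ}

theorem exists_grid_size {L : ℕ} (hd : 1 ≤ d) (hn : L ≤ n) (hL : 1 ≤ L) :
    ∃ m, 1 ≤ m ∧ L * m ^ d ≤ n ∧ n < L * (m + 1) ^ d := by
  classical
  have hex : ∃ m, n < L * (m + 1) ^ d := ⟨n, calc
    n < n + 1 := by omega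
    _ ≤ (n + 1) ^ d := Nat.le_self_pow (by omega) _
    _ ≤ L * (n + 1) ^ d := Nat.le_mul_of_pos_left _ hL⟩
  have hspec := Nat.find_spec hex
  have hpos : 1 ≤ Nat.find hex := by
    rw [Nat.one_le_iff_ne_zero]
    intro e
    rw [e] at hspec
    simp at hspec
    omega
  refine ⟨Nat.find hex, hpos, ?_, hspec⟩
  have := Nat.find_min hex (m := Nat.find hex - 1) (by omega)
  rw [Nat.sub_add_cancel hpos] at this
  omega

/-- The radius is at least `d` times the side of the cells. -/
theorem div_le_radius {L m : ℕ} {r : ℝ} (hd : 1 ≤ d) (hm : 1 ≤ m) (hn : 1 ≤ n)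
    (hm' : n < L * (m + 1) ^ d)
    (hr : ((2 * d : ℝ) ^ d * L / n) ^ (1 / (d : ℝ)) ≤ r) : (d : ℝ) / m ≤ r := by
  have hm0 : (0 : ℝ) < m := by exact_mod_cast hm
  have hn0 : (0 : ℝ) < n := by exact_mod_cast hn
  refine le_trans ?_ hr
  have h1 : ((d : ℝ) / m) ^ d ≤ (2 * d : ℝ) ^ d * L / n := by
    rw [div_pow, div_le_div_iff₀ (by positivity) hn0]
    -- From `m + 1 ≤ 2 * m`, which accounts for the factor `2 ^ d` in `C`.
    have h2 : (n : ℝ) ≤ L * (2 * m : ℝ) ^ d := by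
      have : n ≤ L * (2 * m) ^ d :=
        hm'.le.trans (Nat.mul_le_mul_left _ (Nat.pow_le_pow_left (by omega) d))
      exact_mod_cast this
    calc (d : ℝ) ^ d * n ≤ (d : ℝ) ^ d * (L * (2 * m : ℝ) ^ d) := by gcongr
      _ = (2 * d : ℝ) ^ d * L * (m : ℝ) ^ d := by rw [mul_pow, mul_pow]; ring
  calc (d : ℝ) / m = (((d : ℝ) / m) ^ d) ^ (1 / (d : ℝ)) := by
        rw [one_div, Real.pow_rpow_inv_natCast (by positivity) (by omega)]
    _ ≤ _ := Real.rpow_le_rpow (by positivity) h1 (by positivity)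

/-- The density `L` makes the cost `21 * (n / L) * log 2` of the union bound smaller than the
Chernoff gain `α * n * log (18 / 17)`. -/
theorem exists_density {α : ℝ} (hα : 0 < α) : ∃ L : ℕ, 1 ≤ L ∧
    21 / L * Real.log 2 - α * Real.log (18 / 17) < 0 := by
  have h1 : 0 < α * Real.log (18 / 17) := mul_pos hα (Real.log_pos (by norm_num))
  obtain ⟨L, hL⟩ := exists_nat_gt (21 * Real.log 2 / (α * Real.log (18 / 17)))
  have h2 : (0 : ℝ) < L := lt_of_le_of_lt (by positivity) hL
  refine ⟨L, by exact_mod_cast h2, ?_⟩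
  rw [div_lt_iff₀ h1] at hL
  rw [sub_neg, div_mul_eq_mul_div, div_lt_iff₀ h2]
  linarith

theorem two_pow_mul_pow_le {α : ℝ} {L N D : ℕ} (hL : 1 ≤ L) (hN : L * N ≤ n) (hD : α * n ≤ D) :
    (2 : ℝ) ^ (21 * N) * (17 / 18) ^ D ≤
      Real.exp (21 / L * Real.log 2 - α * Real.log (18 / 17)) ^ n := by
  have hL0 : (0 : ℝ) < L := by exact_mod_cast hL
  have h2 : (2 : ℝ) ^ (21 * N) = Real.exp ((21 * N : ℕ) * Real.log 2) := by
    rw [Real.exp_nat_mul, Real.exp_log (by norm_num)]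
  have h3 : (17 / 18 : ℝ) ^ D = Real.exp (D * -Real.log (18 / 17)) := by
    rw [Real.exp_nat_mul, ← Real.log_inv, Real.exp_log (by norm_num)]
    norm_num
  rw [h2, h3, ← Real.exp_add, ← Real.exp_nat_mul]
  refine Real.exp_le_exp.2 ?_
  have h4 : (N : ℝ) ≤ n / L := by
    rw [le_div_iff₀ hL0]
    exact_mod_cast (mul_comm N L).trans_le hN
  have h5 : (N : ℝ) * Real.log 2 ≤ n / L * Real.log 2 :=
    mul_le_mul_of_nonneg_right h4 (Real.log_nonneg (by norm_num))
  have h6 : α * n * Real.log (18 / 17) ≤ D * Real.log (18 / 17) :=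
    mul_le_mul_of_nonneg_right hD (Real.log_nonneg (by norm_num))
  have h7 : (n : ℝ) * (21 / L * Real.log 2 - α * Real.log (18 / 17)) =
      21 * (n / L * Real.log 2) - α * n * Real.log (18 / 17) := by ring
  rw [h7]
  push_cast
  linarith

theorem Program.FindsHamiltonCycle.isHamiltonian {P : Program} {I : Input d n} {W T : ℕ}
    (h : P.FindsHamiltonCycle I W T) : I.union.IsHamiltonian := by
  obtain ⟨-, -, -, -, -, a, p, hp, -⟩ := h
  exact fun _ => ⟨a, p, hp⟩

theorem hamiltonProgram_sound {L : ℕ} {I : Input d n} (hd : 1 ≤ d) (hL : 1 ≤ L) (hn : 1 ≤ n)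
    (hr : 0 < I.radius) :
    (hamiltonProgram d L).Sound I ((n + 1) ^ 1) ((5 * d + 100) * n ^ 2) := by
  rw [pow_one]
  obtain ⟨t, σ, ht, he, hs, -⟩ := runs_hamiltonProgram (I := I) hd hL hn hr
  exact ⟨t, σ, ht, he, hs⟩

theorem hamiltonProgram_finds {L m : ℕ} {I : Input d n} (hd : 1 ≤ d) (hL : 1 ≤ L) (hn : 3 ≤ n)
    (hm : 1 ≤ m) (hm₁ : L * m ^ d ≤ n) (hm₂ : n < L * (m + 1) ^ d)
    (hr : ((2 * d : ℝ) ^ d * L / n) ^ (1 / (d : ℝ)) ≤ I.radius)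
    (hI : ∀ i, I.pos i ∈ unitCube d) (hw : WellSpread n (m ^ d) I.EdgeN (I.cellN m)) :
    (hamiltonProgram d L).FindsHamiltonCycle I ((n + 1) ^ 1) ((5 * d + 100) * n ^ 2) := by
  have hdm := div_le_radius hd hm (by omega) hm₂ hr
  have hpos : 0 < I.radius := by
    refine lt_of_lt_of_le ?_ hdm
    have : (0 : ℝ) < d := by exact_mod_cast hd
    have : (0 : ℝ) < m := by exact_mod_cast hm
    positivity
  rw [pow_one]
  obtain ⟨t, σ, ht, he, hs, hs'⟩ := runs_hamiltonProgram (I := I) hd hL (by omega) hpos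
  have := hs' m _ (.inr hm₁) hm₂ hn hw fun u hu v hv h => near_of_cellN_eq hm hI hdm hu hv h
  exact ⟨t, σ, ht, he, this, hs this⟩

/-- The failure probability is at most `n * q ^ n` with `q < 1`, since almost surely all points lie
in the cube and well-spread neighbourhoods then guarantee success. -/
theorem aas_finds {α : ℝ} {L : ℕ} (hd : 1 ≤ d) (hL : 1 ≤ L)
    (hLα : 21 / L * Real.log 2 - α * Real.log (18 / 17) < 0)
    (r : ℕ → ℝ) (H : ∀ n : ℕ, SimpleGraph (Fin n)) [∀ n, DecidableRel (H n).Adj]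
    (hr : ∀ᶠ n : ℕ in atTop, ((2 * d : ℝ) ^ d * L / n) ^ (1 / (d : ℝ)) ≤ r n)
    (hH : ∀ᶠ n : ℕ in atTop, α * n ≤ ((H n).minDegree : ℝ)) :
    AAS d (fun n x => (hamiltonProgram d L).FindsHamiltonCycle (Input.mk (H n) x (r n))
      ((n + 1) ^ 1) ((5 * d + 100) * n ^ 2)) := by
  classical
  refine AAS.of_compl_le (tendsto_self_mul_const_pow_of_lt_one (Real.exp_pos _).le
    (by rwa [Real.exp_lt_one_iff])) ?_
  filter_upwards [hr, hH, eventually_ge_atTop (L + 3)] with n hr hH hn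
  obtain ⟨m, hm, hm₁, hm₂⟩ := exists_grid_size (n := n) hd (by omega) hL
  have hdeg : ∀ v, (H n).minDegree ≤ (Finset.univ.filter fun u => (H n).Adj v u).card := fun v => by
    have := (H n).minDegree_le_degree v
    rwa [← SimpleGraph.card_neighborFinset_eq_degree, SimpleGraph.neighborFinset_eq_filter] at this
  calc _ ≤ (randomPoints d n).real {x | ¬ WellSpread n (m ^ d) (Input.mk (H n) x (r n)).EdgeN
        ((Input.mk (H n) x (r n)).cellN m)} := by
        refine ENNReal.toReal_mono (measure_ne_top _ _) (measure_mono_ae ?_)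
        filter_upwards [ae_mem_unitCube d n] with x hx hnot hw
        exact hnot (hamiltonProgram_finds hd hL (by omega) hm hm₁ hm₂ hr hx hw)
    _ ≤ n * (2 ^ (21 * m ^ d) * (17 / 18) ^ (H n).minDegree) :=
        randomPoints_not_wellSpread_le hm (H n) (fun v => by convert hdeg v) (r n)
    _ ≤ _ := mul_le_mul_of_nonneg_left (two_pow_mul_pow_le hL hm₁ hH) (by positivity)

end main

end PerturbedGeometric

theorem theorem1p1 (d : ℕ) (hd : 1 ≤ d) (α : ℝ) (hα₀ : 0 < α) (hα : α < 1 / 2) :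
    ∃ C : ℝ, 0 < C ∧ ∃ (P : Program) (K k : ℕ),
      -- the algorithm always halts within `K n ^ 2` steps and never outputs a wrong answer
      (∀ n : ℕ, 1 ≤ n → ∀ (H : SimpleGraph (Fin n)) (x : Fin n → EuclideanSpace ℝ (Fin d)) (ρ : ℝ),
        (∀ i, x i ∈ unitCube d) → 0 < ρ →
          P.Sound (Input.mk H x ρ) ((n + 1) ^ k) (K * n ^ 2)) ∧
      ∀ (r : ℕ → ℝ) (H : ∀ n : ℕ, SimpleGraph (Fin n)) [∀ n, DecidableRel (H n).Adj],
        (∀ᶠ n : ℕ in atTop, (C / n) ^ (1 / (d : ℝ)) ≤ r n) →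
        (∀ᶠ n : ℕ in atTop, α * n ≤ ((H n).minDegree : ℝ)) →
          AAS d (fun n x => (H n ⊔ geometricGraph x (r n)).IsHamiltonian) ∧
          AAS d (fun n x =>
            P.FindsHamiltonCycle (Input.mk (H n) x (r n)) ((n + 1) ^ k) (K * n ^ 2)) := by
  obtain ⟨L, hL, hLα⟩ := exists_density hα₀
  have hd0 : (0 : ℝ) < d := by exact_mod_cast hd
  have hL0 : (0 : ℝ) < L := by exact_mod_cast hL
  refine ⟨(2 * d : ℝ) ^ d * L, by positivity, hamiltonProgram d L, 5 * d + 100, 1,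
    fun n hn H x ρ _ hρ => hamiltonProgram_sound hd hL hn hρ, fun r H _ hr hH => ?_⟩
  have h := aas_finds hd hL hLα r H hr hH
  -- Hamiltonicity is a consequence of the success of the algorithm.
  exact ⟨h.mono fun n x hx => hx.isHamiltonian, h⟩
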